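/- Let $\mathfrak H=\{z=x+iy: y>0\}$ with the invariant measure $d\mu=\frac{dx\,dy}{y^2}$ and the invariant Laplacian $\Delta=y^2\left(\frac{\partial^2}{\partial x^2}+\frac{\partial^2}{\partial y^2}\right)$, both descended to the modular curve $X=SL_2(\mathbb Z)\backslash SL_2(\mathbb R)/SO(2,\mathbb R)=SL_2(\mathbb Z)\backslash\mathfrak H$. Let $C_c^\infty(X)$ be the space of complex-valued, compactly supported functions on $X$ whose pullback to $\mathfrak H$ is smooth. Let $q:X\to\mathbb R$ be a non-negative, locally integrable function such that $q(x+iy)\gg y^{\varepsilon}$ for some $\varepsilon>0$; that is, there are constants $C>0$ and $c$ with $q(x+iy)\ge C\,y^{\varepsilon}$ whenever $y\ge c$. Put $S=-\Delta+q$. Then $\langle Sf,g\rangle_{L^2}=\int_X (Sf)\,\overline g\,d\mu$ is a (positive-definite, Hermitian) inner product on $C_c^\infty(X)$. Let $V^1$ be the Hilbert-space completion of $C_c^\infty(X)$ with respect to the norm given by $|f|_{V^1}^2=\langle Sf,f\rangle_{L^2}$. The identity map on $C_c^\infty(X)$ extends to a continuous linear injection $V^1\to L^2(X)$, and this inclusion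 is a compact operator. -/

import Mathlib

open MeasureTheory Set Filter Topology
open scoped MatrixGroups UpperHalfPlane ContDiff ComplexConjugate InnerProductSpace

namespace ModularCurve

/-- The modular curve `SL₂(ℤ) \ ℍ`, i.e. `SL₂(ℤ) \ SL₂(ℝ) / SO(2, ℝ)`, with its quotient topology
and quotient σ-algebra. -/
abbrev X : Type := MulAction.orbitRel.Quotient SL(2, ℤ) ℍ

/-- The projection `ℍ → SL₂(ℤ) \ ℍ`. -/
noncomputable def proj (z : ℍ) : X := Quotient.mk _ z

lemma proj_smul (γ : SL(2, ℤ)) (z : ℍ) : proj (γ • z) = proj z :=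
  MulAction.orbitRel.Quotient.quotient_smul_eq

/-- The invariant measure `dx dy / y²` on `SL₂(ℤ) \ ℍ`: the image of the invariant measure of `ℍ`
restricted to the standard fundamental domain `{|z| ≥ 1, |Re z| ≤ 1/2}`. -/
noncomputable def measure : Measure X :=
  ((volume : Measure ℍ).restrict ModularGroup.fd).map proj

/-- A function on the modular curve, as an automorphic function of the complex coordinate of `ℍ`
(only its values on the open upper half-plane matter). -/
noncomputable def lift (f : X → ℂ) (w : ℂ) : ℂ := f (proj (UpperHalfPlane.ofComplex w))

/-- The test functions `C_c^∞(SL₂(ℤ) \ ℍ)`: complex-valued functions on the modular curve which have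
compact support there and whose lift to the upper half-plane is smooth in the real sense. -/
def testFunctions : Submodule ℂ (X → ℂ) where
  carrier := {f | ContDiffOn ℝ ∞ (lift f) UpperHalfPlane.upperHalfPlaneSet ∧ HasCompactSupport f}
  add_mem' := fun hf hg => ⟨hf.1.add hg.1, hf.2.add hg.2⟩
  zero_mem' := ⟨contDiffOn_const, HasCompactSupport.zero⟩
  smul_mem' := fun c _ hf => ⟨contDiffOn_const.smul hf.1,
    hf.2.mono (Function.support_const_smul_subset c _)⟩

/-- The Laplacian in the plane of a composition with a holomorphic map. -/
lemma laplacian_comp_holomorphic {F h : ℂ → ℂ} {w : ℂ} (hh : AnalyticAt ℂ h w)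
    (hF : ContDiffAt ℝ 2 F (h w)) :
    Laplacian.laplacian (F ∘ h) w = ((‖deriv h w‖ ^ 2 : ℝ) : ℂ) * Laplacian.laplacian F (h w) := by
  have hder : ∀ u, AnalyticAt ℂ h u →
      HasFDerivAt h (ContinuousLinearMap.mul ℝ ℂ (deriv h u)) u := by
    intro u hu
    convert! hu.differentiableAt.hasDerivAt.hasFDerivAt.restrictScalars ℝ using 1
    ext v
    all_goals simp [mul_comm]
  have hder2 : HasFDerivAt (deriv h) (ContinuousLinearMap.mul ℝ ℂ (deriv (deriv h) w)) w := by
    convert! hh.deriv.differentiableAt.hasDerivAt.hasFDerivAt.restrictScalars ℝ using 1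
    ext v
    all_goals simp [mul_comm]
  have hFev : ∀ᶠ u in 𝓝 w, ContDiffAt ℝ 2 F (h u) :=
    hh.continuousAt.eventually (hF.eventually (by simp))
  have hev : fderiv ℝ (F ∘ h) =ᶠ[𝓝 w] fun u =>
      (fderiv ℝ F (h u)).comp (ContinuousLinearMap.mul ℝ ℂ (deriv h u)) := by
    filter_upwards [hh.eventually_analyticAt, hFev] with u hu hFu
    exact ((hFu.differentiableAt (by norm_num)).hasFDerivAt.comp u (hder u hu)).fderiv
  have hD : HasFDerivAt (fderiv ℝ F) (fderiv ℝ (fderiv ℝ F) (h w)) (h w) :=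
    ((hF.fderiv_right (m := 1) (by norm_num)).differentiableAt (by norm_num)).hasFDerivAt
  have h2 := ((hD.comp w (hder w hh)).clm_comp
    ((ContinuousLinearMap.mul ℝ ℂ).hasFDerivAt.comp w hder2)).congr_of_eventuallyEq hev
  have key : ∀ v : ℂ, iteratedFDeriv ℝ 2 (F ∘ h) w ![v, v] =
      fderiv ℝ (fderiv ℝ F) (h w) (deriv h w * v) (deriv h w * v) +
        fderiv ℝ F (h w) (deriv (deriv h) w * v * v) := by
    intro v
    rw [iteratedFDeriv_two_apply, h2.fderiv]
    simp [add_comm]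
  have hI : deriv (deriv h) w * Complex.I * Complex.I = -(deriv (deriv h) w) := by
    rw [mul_assoc, Complex.I_mul_I, mul_neg_one]
  simp only [InnerProductSpace.laplacian_eq_iteratedFDeriv_complexPlane]
  rw [key, key, hI]
  simp only [iteratedFDeriv_two_apply, mul_one, map_neg]
  set B := fderiv ℝ (fderiv ℝ F) (h w)
  have e1 : deriv h w = (deriv h w).re • (1 : ℂ) + (deriv h w).im • Complex.I := by
    simp [Complex.re_add_im]
  have e2 : deriv h w * Complex.I = (deriv h w).re • Complex.I - (deriv h w).im • (1 : ℂ) := by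
    apply Complex.ext <;> simp
  rw [e2]
  have e3 : B (deriv h w) (deriv h w) = B ((deriv h w).re • (1 : ℂ) + (deriv h w).im • Complex.I)
      ((deriv h w).re • (1 : ℂ) + (deriv h w).im • Complex.I) := by rw [← e1]
  rw [e3, ← Complex.normSq_eq_norm_sq, Complex.normSq_apply]
  simp only [map_add, map_sub, map_smul, add_apply, sub_apply, smul_apply]
  simp only [Complex.real_smul]
  push_cast
  ring

/-- `y² (∂²/∂x² + ∂²/∂y²)` on functions of the complex coordinate of `ℍ`. -/
noncomputable def hyperbolicLaplacian (F : ℂ → ℂ) (z : ℍ) : ℂ :=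
  ((z.im ^ 2 : ℝ) : ℂ) * Laplacian.laplacian F (z : ℂ)

lemma hyperbolicLaplacian_lift_smul (f : testFunctions) (γ : SL(2, ℤ)) (z : ℍ) :
    hyperbolicLaplacian (lift f) (γ • z) = hyperbolicLaplacian (lift f) z := by
  set g : GL (Fin 2) ℝ := Matrix.SpecialLinearGroup.mapGL ℝ γ
  have hg : γ • z = g • z := rfl
  have hdet : g.val.det = 1 := by
    rw [Matrix.SpecialLinearGroup.mapGL_coe_matrix]
    exact (Matrix.SpecialLinearGroup.map (algebraMap ℤ ℝ) γ).det_coe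
  have hpos : 0 < g.val.det := by simp [hdet]
  set h : ℂ → ℂ := fun w => ((g • UpperHalfPlane.ofComplex w : ℍ) : ℂ)
  have hz : h z = ((γ • z : ℍ) : ℂ) := by simp [h, hg]
  have hcomp : lift f ∘ h = lift f := by
    funext w
    simp only [lift, h, Function.comp_apply, UpperHalfPlane.ofComplex_apply]
    exact congrArg _ (proj_smul γ _)
  have hF : ContDiffAt ℝ 2 (lift f) (h z) := by
    rw [hz]
    exact ((f.2.1.contDiffAt
      (UpperHalfPlane.isOpen_upperHalfPlaneSet.mem_nhds (γ • z).im_pos)).of_le ENat.LEInfty.out)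
  have key := laplacian_comp_holomorphic (UpperHalfPlane.analyticAt_smul hpos z) hF
  rw [hcomp, UpperHalfPlane.deriv_smul hpos, UpperHalfPlane.ofComplex_apply, ← hg] at key
  have him : (γ • z).im = z.im / ‖UpperHalfPlane.denom g z‖ ^ 2 := by
    rw [hg, UpperHalfPlane.im_smul_eq_div_normSq, Complex.normSq_eq_norm_sq,
      Matrix.GeneralLinearGroup.val_det_apply, hdet]
    simp
  have hd : ‖UpperHalfPlane.denom g z‖ ≠ 0 := norm_ne_zero_iff.mpr (UpperHalfPlane.denom_ne_zero g z)
  rw [hyperbolicLaplacian, hyperbolicLaplacian, key, ← mul_assoc, ← Complex.ofReal_mul]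
  congr 2
  rw [him, hdet]
  simp
  field_simp

/-- The invariant Laplacian `Δ` on test functions on the modular curve. -/
noncomputable def laplacian (f : testFunctions) : X → ℂ :=
  Quotient.lift (hyperbolicLaplacian (lift f)) (by
    rintro _ z ⟨γ, rfl⟩
    exact hyperbolicLaplacian_lift_smul f γ z)

/-- The Hamiltonian `S = -Δ + q`. -/
noncomputable def hamiltonian (q : X → ℝ) (f : testFunctions) (x : X) : ℂ :=
  -laplacian f x + (q x : ℂ) * (f : X → ℂ) x

/-- `⟨S f, g⟩ = ∫ (S f) · conj g` over the modular curve. -/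
noncomputable def energy (q : X → ℝ) (f g : testFunctions) : ℂ :=
  ∫ x, hamiltonian q f x * conj ((g : X → ℂ) x) ∂measure

/-- `⟨S f, g⟩` is a (complex, positive definite) inner product on the test functions. -/
structure IsInnerProduct (q : X → ℝ) : Prop where
  add_left : ∀ f₁ f₂ g, energy q (f₁ + f₂) g = energy q f₁ g + energy q f₂ g
  smul_left : ∀ (a : ℂ) (f g), energy q (a • f) g = a * energy q f g
  conj_symm : ∀ f g, conj (energy q g f) = energy q f g
  nonneg : ∀ f, 0 ≤ (energy q f f).re
  definite : ∀ f, energy q f f = 0 → f = 0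

/-- The inner product on test functions given by `⟨S f, g⟩`; the arguments are interchanged because
Mathlib's inner products are conjugate-linear in the first variable. -/
@[reducible]
noncomputable def energyCore {q : X → ℝ} (hq : IsInnerProduct q) :
    InnerProductSpace.Core ℂ testFunctions where
  inner f g := energy q g f
  conj_inner_symm f g := hq.conj_symm g f
  re_inner_nonneg f := hq.nonneg f
  add_left f g h := by
    rw [← hq.conj_symm, hq.add_left, map_add, hq.conj_symm, hq.conj_symm]
  smul_left f g r := by
    rw [← hq.conj_symm, hq.smul_left, map_mul, hq.conj_symm]
  definite f hf := hq.definite f hf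

/-- The space of test functions, with the norm `|f|² = ⟨S f, f⟩`. -/
def PreV1 {q : X → ℝ} (_ : IsInnerProduct q) : Type := testFunctions

/-- A test function as an element of the normed space `PreV1`. -/
def PreV1.of {q : X → ℝ} (hq : IsInnerProduct q) (f : testFunctions) : PreV1 hq := f

noncomputable instance {q : X → ℝ} (hq : IsInnerProduct q) : NormedAddCommGroup (PreV1 hq) :=
  @InnerProductSpace.Core.toNormedAddCommGroup ℂ testFunctions _ _ _ (energyCore hq)

noncomputable instance {q : X → ℝ} (hq : IsInnerProduct q) : InnerProductSpace ℂ (PreV1 hq) :=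
  @InnerProductSpace.ofCore ℂ testFunctions _ _ _ (energyCore hq).toCore

/-- The Hilbert space `V¹`: the completion of the test functions for `|f|² = ⟨S f, f⟩`. -/
abbrev V1 {q : X → ℝ} (hq : IsInnerProduct q) : Type := UniformSpace.Completion (PreV1 hq)

/-- A test function as an element of `V¹`. -/
noncomputable def toV1 {q : X → ℝ} (hq : IsInnerProduct q) (f : testFunctions) : V1 hq :=
  ((PreV1.of hq f : PreV1 hq) : UniformSpace.Completion (PreV1 hq))

/-- The Hilbert space `L²(SL₂(ℤ) \ ℍ)`. -/
abbrev L2 : Type := Lp ℂ 2 measure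

end ModularCurve

namespace ModularCurve

open scoped Pointwise

/-! Integration by parts on the modular curve turns `⟨S f, f⟩` into the Dirichlet integral `∫ |∇f|²`
plus `∫ q |f|²`. Both terms are non-negative and the form is visibly Hermitian. Green's formula
(`integral_gradProduct`) is proved by unfolding: one of the two functions is written as a sum of
translates of a compactly supported `u` on the half-plane, which moves the integral to the plane,
where there are no boundary terms.

For compactness, cut the fundamental domain at a height `T`. Above `T` the growth of `q` gives `∫
|f|² ≤ (C T^ε)⁻¹ ∫ q |f|²`, which is small relative to the energy when `T` is large
(`lintegral_cusp_le`). Below `T` everything lies in a Euclidean rectangle. Divided into small cells,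
the rectangle satisfies a Poincaré inequality on each cell, so `∫ |f|²` is at most a small multiple
of the energy plus finitely many squared cell integrals (`exists_finite_functionals`). An operator
controlled in this way for every `η` sends the unit ball to a totally bounded set
(`totallyBounded_image_ball_of_finite_functionals`); this replaces an appeal to Rellich's theorem.

The same Poincaré argument, anchored on a square high enough for `q` to be bounded below, gives
`‖f‖² ≤ K ⟨S f, f⟩` (`exists_lintegral_norm_sq_le_energy`). Hence the form is definite and the
inclusion extends to `V¹`.

Injectivity of the extension is not automatic, since a completion can acquire a kernel. It amounts
to closability of the form: an energy-Cauchy sequence tending to `0` in `L²` tends to `0` in energy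
(`tendsto_preV1_zero`). The gradient part follows from Green's formula, the potential part from
Fatou's lemma. -/

/-! ### Topology and measure of the quotient; the fundamental domain. -/

instance : ContinuousConstSMul SL(2, ℤ) ℍ where
  continuous_const_smul γ :=
    continuous_const_smul (Matrix.SpecialLinearGroup.mapGL ℝ γ : GL (Fin 2) ℝ)

instance : Countable SL(2, ℤ) :=
  Function.Injective.countable (β := Fin 2 → Fin 2 → ℤ) (f := fun γ => γ.1) Subtype.val_injective

lemma isOpenQuotientMap_proj : IsOpenQuotientMap proj :=
  MulAction.isOpenQuotientMap_quotientMk (Γ := SL(2, ℤ)) (T := ℍ)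

lemma measurable_proj : Measurable proj := fun _ h => h

instance : OpensMeasurableSpace X where
  borel_le := by
    refine MeasurableSpace.generateFrom_le fun s hs => ?_
    exact (isOpenQuotientMap_proj.continuous.isOpen_preimage s hs).measurableSet

instance : ProperlyDiscontinuousSMul SL(2, ℤ) ℍ where
  finite_disjoint_inter_image {K L} hK hL := by
    have h := ProperlyDiscontinuousSMul.finite_disjoint_inter_image (Γ := 𝒮ℒ) hK hL
    refine Set.Finite.of_finite_image (f := fun γ : SL(2, ℤ) =>
      (⟨Matrix.SpecialLinearGroup.mapGL ℝ γ, γ, rfl⟩ : 𝒮ℒ)) (h.subset ?_) ?_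
    · rintro _ ⟨γ, hγ, rfl⟩
      exact hγ
    · exact fun γ _ γ' _ h => Matrix.SpecialLinearGroup.mapGL_injective (congrArg Subtype.val h)

instance : T2Space X := t2Space_of_properlyDiscontinuousSMul_of_t2Space (Γ := SL(2, ℤ)) (T := ℍ)

lemma exists_eq_smul_of_proj_eq {z w : ℍ} (h : proj z = proj w) : ∃ γ : SL(2, ℤ), γ • w = z :=
  Quotient.exact h

/-- The modular group acting faithfully on the upper half-plane. -/
noncomputable def modGroup : Subgroup (Equiv.Perm ℍ) := (MulAction.toPermHom SL(2, ℤ) ℍ).range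

lemma modGroup_exists (σ : modGroup) : ∃ γ : SL(2, ℤ), ∀ z : ℍ, σ • z = γ • z := by
  obtain ⟨_, γ, rfl⟩ := σ
  exact ⟨γ, fun _ => rfl⟩

/-- The action of an integral matrix as an element of the faithful modular group. -/
noncomputable def toModGroup (γ : SL(2, ℤ)) : modGroup := ⟨MulAction.toPermHom SL(2, ℤ) ℍ γ, γ, rfl⟩

lemma toModGroup_smul (γ : SL(2, ℤ)) (z : ℍ) : toModGroup γ • z = γ • z := rfl

lemma proj_modGroup_smul (σ : modGroup) (z : ℍ) : proj (σ • z) = proj z := by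
  obtain ⟨γ, h⟩ := modGroup_exists σ
  rw [h, proj_smul]

instance : Countable modGroup :=
  (MonoidHom.rangeRestrict_surjective (MulAction.toPermHom SL(2, ℤ) ℍ)).countable

instance : ContinuousConstSMul modGroup ℍ where
  continuous_const_smul σ := by
    obtain ⟨γ, h⟩ := modGroup_exists σ
    simp_rw [h]
    exact continuous_const_smul γ

instance : MeasurableConstSMul modGroup ℍ where
  measurable_const_smul σ := (continuous_const_smul σ).measurable

instance : SMulInvariantMeasure modGroup ℍ volume where
  measure_preimage_smul σ s hs := by
    obtain ⟨γ, h⟩ := modGroup_exists σ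
    simp_rw [h]
    exact measure_preimage_smul_of_nullMeasurableSet
      (G := GL (Fin 2) ℝ) hs.nullMeasurableSet (Matrix.SpecialLinearGroup.mapGL ℝ γ)

lemma volume_eq_zero_of_image {s : Set ℍ} (h : volume (UpperHalfPlane.coe '' s) = 0) :
    volume s = 0 := by
  rw [UpperHalfPlane.volume_eq_lintegral, Measure.restrict_eq_zero.mpr h, lintegral_zero_measure]

lemma volume_re_eq (c : ℝ) : volume {w : ℂ | w.re = c} = 0 := by
  have : {w : ℂ | w.re = c} = Complex.measurableEquivRealProd ⁻¹' ({c} ×ˢ univ) := by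
    ext w; simp [Complex.measurableEquivRealProd_apply]
  rw [this, Complex.volume_preserving_equiv_real_prod.measure_preimage
    ((measurableSet_singleton c).prod MeasurableSet.univ).nullMeasurableSet,
    Measure.volume_eq_prod, Measure.prod_prod]
  simp

lemma volume_fd_diff_fdo : volume (ModularGroup.fd \ ModularGroup.fdo) = 0 := by
  refine volume_eq_zero_of_image (measure_mono_null
    (t := Metric.sphere 0 1 ∪ ({w : ℂ | w.re = 1 / 2} ∪ {w : ℂ | w.re = -(1 / 2)})) ?_ ?_)
  · rintro _ ⟨z, ⟨⟨h1, h2⟩, h3⟩, rfl⟩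
    rcases h1.lt_or_eq with h | h
    · right
      have : |z.re| = 1 / 2 := le_antisymm h2 (not_lt.mp fun h' => h3 ⟨h, h'⟩)
      exact (abs_eq (by norm_num)).mp this
    · left
      rw [Complex.normSq_eq_norm_sq] at h
      have : ‖(z : ℂ)‖ = 1 := by
        exact (pow_eq_one_iff_of_nonneg (norm_nonneg _) two_ne_zero).mp h.symm
      simpa using this
  · simp only [measure_union_null_iff]
    exact ⟨Measure.addHaar_sphere _ _ _, volume_re_eq _, volume_re_eq _⟩

lemma measurableSet_fd : MeasurableSet ModularGroup.fd := ModularGroup.isClosed_fd.measurableSet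

/-- The group must act faithfully here: `-1` acts trivially, so in `SL(2, ℤ)` the translates would
not be almost disjoint. If `σ` moves a point of the open domain `fdo` into `fd`, its matrix is `±1`
and `σ = 1`. Overlaps for `σ ≠ 1` therefore lie over the boundary, which is null. -/
lemma isFundamentalDomain_fd : IsFundamentalDomain modGroup ModularGroup.fd (volume : Measure ℍ) := by
  refine .mk'' measurableSet_fd.nullMeasurableSet ?_ ?_
    fun σ => (measurePreserving_smul σ volume).quasiMeasurePreserving
  · refine .of_forall fun z => ?_
    obtain ⟨γ, h⟩ := ModularGroup.exists_smul_mem_fd z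
    exact ⟨toModGroup γ, h⟩
  · intro σ hσ
    refine measure_mono_null (t := σ • (ModularGroup.fd \ ModularGroup.fdo)) ?_ ?_
    · rintro _ ⟨⟨z, hz, rfl⟩, hz'⟩
      refine ⟨z, ⟨hz, fun hzo => hσ ?_⟩, rfl⟩
      obtain ⟨γ, h⟩ := modGroup_exists σ
      simp only [h] at hz'
      have : ∀ z : ℍ, γ • z = z := by
        rcases ModularGroup.eq_one_or_neg_one_of_mem_fdo_mem_fd hzo hz' with rfl | rfl <;> simp
      ext z : 2
      have := h z
      rw [‹∀ z : ℍ, γ • z = z›] at this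
      exact this
    · rw [measure_smul, volume_fd_diff_fdo]

/-- The unfolding identity: the translates of the fundamental domain tile the half-plane, and
integrability of `U` allows sum and integral to be exchanged. -/
lemma setIntegral_fd_tsum_smul {U : ℍ → ℂ} (hU : Integrable U) :
    ∫ z in ModularGroup.fd, ∑' σ : modGroup, U (σ • z) = ∫ z, U z := by
  rw [isFundamentalDomain_fd.integral_eq_tsum'' U hU]
  refine (integral_tsum (f := fun (σ : modGroup) z => U (σ • z)) (fun σ => ?_) ?_)
  · exact ((measurePreserving_smul σ volume).integrable_comp_of_integrable hU).aestronglyMeasurable.restrict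
  · rw [← isFundamentalDomain_fd.lintegral_eq_tsum'' (fun z => ‖U z‖ₑ)]
    exact hU.2.ne

/-- Because `proj` is open, the images of interiors of compact neighbourhoods form an open cover of
`K`; a finite subcover suffices. -/
lemma exists_isCompact_subset_image_proj {K : Set X} (hK : IsCompact K) :
    ∃ C : Set ℍ, IsCompact C ∧ K ⊆ proj '' interior C := by
  choose N hNc hN using fun z : ℍ => exists_compact_mem_nhds z
  obtain ⟨t, ht⟩ := hK.elim_finite_subcover (fun z : ℍ => proj '' interior (N z))
    (fun z => isOpenQuotientMap_proj.isOpenMap _ isOpen_interior) (fun x _ => by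
      obtain ⟨z, rfl⟩ := isOpenQuotientMap_proj.surjective x
      exact mem_iUnion.mpr ⟨z, z, mem_interior_iff_mem_nhds.mpr (hN z), rfl⟩)
  refine ⟨⋃ z ∈ t, N z, t.isCompact_biUnion fun z _ => hNc z, fun x hx => ?_⟩
  obtain ⟨z, hz, w, hw, rfl⟩ := mem_iUnion₂.mp (ht hx)
  exact ⟨w, interior_mono (subset_biUnion_of_mem (u := fun z => N z) hz) hw, rfl⟩

lemma measure_apply {s : Set X} (hs : MeasurableSet s) :
    measure s = volume (proj ⁻¹' s ∩ ModularGroup.fd) := by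
  rw [measure, Measure.map_apply measurable_proj hs, Measure.restrict_apply (measurable_proj hs)]

/-- The part of the fundamental domain lying over the image of `C` is covered by the translates of
`C`, and the measures of their traces on the domain add up to the finite volume of `C`. -/
instance : IsFiniteMeasureOnCompacts measure where
  lt_top_of_isCompact K hK := by
    obtain ⟨C, hC, hKC⟩ := exists_isCompact_subset_image_proj hK
    have hU := isOpenQuotientMap_proj.isOpenMap _ (isOpen_interior (s := C))
    refine (measure_mono hKC).trans_lt ?_
    rw [measure_apply hU.measurableSet]
    refine lt_of_le_of_lt ?_ (hC.measure_lt_top (μ := volume))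
    rw [isFundamentalDomain_fd.measure_eq_tsum C]
    refine (measure_mono (t := ⋃ σ : modGroup, σ • C ∩ ModularGroup.fd) ?_).trans
      (measure_iUnion_le _)
    rintro z ⟨⟨w, hw, hwz⟩, hz⟩
    obtain ⟨γ, rfl⟩ := exists_eq_smul_of_proj_eq hwz.symm
    exact mem_iUnion.mpr ⟨toModGroup γ, ⟨w, interior_subset hw, rfl⟩, hz⟩

lemma volume_ne_zero_of_isOpen {V : Set ℍ} (hV : IsOpen V) (hne : V.Nonempty) :
    volume V ≠ 0 := by
  rw [UpperHalfPlane.volume_eq_lintegral, ← pos_iff_ne_zero, setLIntegral_pos_iff (by fun_prop)]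
  have : (Function.support fun z : ℂ => (((1 / ‖z.im‖₊) ^ 2 : NNReal) : ENNReal)) ∩
      UpperHalfPlane.coe '' V = UpperHalfPlane.coe '' V := by
    refine inter_eq_right.mpr ?_
    rintro _ ⟨z, -, rfl⟩
    simp [z.im_ne_zero]
  rw [this]
  exact (UpperHalfPlane.isOpenEmbedding_coe.isOpenMap V hV).measure_pos _ (hne.image _)

/-- An invariant set that is null in the fundamental domain is null in `ℍ`, which a non-empty open
set is not. This later upgrades almost everywhere equality of continuous functions to equality. -/
instance : Measure.IsOpenPosMeasure measure where
  open_pos U hU hne h0 := by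
    have hV := hU.preimage isOpenQuotientMap_proj.continuous
    rw [measure_apply hU.measurableSet] at h0
    have h1 := isFundamentalDomain_fd.measure_zero_of_invariant (proj ⁻¹' U) (fun σ => by
      ext z
      rw [mem_smul_set_iff_inv_smul_mem, mem_preimage, proj_modGroup_smul, mem_preimage]) h0
    obtain ⟨x, hx⟩ := hne
    obtain ⟨z, rfl⟩ := isOpenQuotientMap_proj.surjective x
    exact volume_ne_zero_of_isOpen hV ⟨z, hx⟩ h1

lemma finite_modGroup_inter {K L : Set ℍ} (hK : IsCompact K) (hL : IsCompact L) :
    {σ : modGroup | ((σ • ·) '' K ∩ L).Nonempty}.Finite := by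
  have h := ProperlyDiscontinuousSMul.finite_disjoint_inter_image (Γ := SL(2, ℤ)) hK hL
  refine (h.image toModGroup).subset fun σ hσ => ?_
  obtain ⟨_, γ, rfl⟩ := σ
  exact ⟨γ, hσ, rfl⟩

lemma integral_measure {F : X → ℂ} (hF : AEStronglyMeasurable F measure) :
    ∫ x, F x ∂measure = ∫ z in ModularGroup.fd, F (proj z) :=
  integral_map measurable_proj.aemeasurable hF

lemma lintegral_measure {F : X → ENNReal} (hF : AEMeasurable F measure) :
    ∫⁻ x, F x ∂measure = ∫⁻ z in ModularGroup.fd, F (proj z) :=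
  lintegral_map' hF measurable_proj.aemeasurable

/-! ### Invariant integrals in Euclidean coordinates. -/

lemma integral_upperHalfPlane (Ψ : ℂ → ℂ) :
    ∫ z : ℍ, ((z.im ^ 2 : ℝ) : ℂ) * Ψ z = ∫ w in UpperHalfPlane.upperHalfPlaneSet, Ψ w := by
  have h : Measurable fun z : ℍ => (1 / NNReal.mk z.im z.im_pos.le : NNReal) ^ 2 := by
    refine ((measurable_const.div ?_).pow_const 2)
    exact (UpperHalfPlane.continuous_im.measurable).subtype_mk
  rw [UpperHalfPlane.volume_def, integral_withDensity_eq_integral_smul h,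
    ← UpperHalfPlane.range_coe, ← UpperHalfPlane.measurableEmbedding_coe.map_comap,
    UpperHalfPlane.measurableEmbedding_coe.integral_map]
  refine integral_congr_ae (.of_forall fun z => ?_)
  have := Complex.ofReal_ne_zero.mpr z.im_ne_zero
  simp only [NNReal.smul_def, Complex.real_smul]
  push_cast
  field_simp

lemma lintegral_upperHalfPlane (Φ : ℂ → ENNReal) (s : Set ℂ) (hs : MeasurableSet s) :
    ∫⁻ z in UpperHalfPlane.coe ⁻¹' s, Φ z =
      ∫⁻ w in s ∩ UpperHalfPlane.upperHalfPlaneSet, ENNReal.ofReal (1 / w.im ^ 2) * Φ w := by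
  have h : Measurable fun z : ℍ => (1 / NNReal.mk z.im z.im_pos.le : NNReal) ^ 2 := by
    refine ((measurable_const.div ?_).pow_const 2)
    exact (UpperHalfPlane.continuous_im.measurable).subtype_mk
  rw [← lintegral_indicator (UpperHalfPlane.measurable_coe hs), UpperHalfPlane.volume_def,
    lintegral_withDensity_eq_lintegral_mul_non_measurable _ h.coe_nnreal_ennreal (by simp),
    ← Measure.restrict_restrict hs, ← lintegral_indicator hs,
    ← UpperHalfPlane.range_coe, ← UpperHalfPlane.measurableEmbedding_coe.map_comap,
    UpperHalfPlane.measurableEmbedding_coe.lintegral_map]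
  refine lintegral_congr fun z => ?_
  by_cases hz : (z : ℂ) ∈ s
  · rw [Pi.mul_apply, indicator_of_mem (by exact hz), indicator_of_mem hz]
    congr 1
    rw [ENNReal.ofReal, ENNReal.coe_inj]
    ext
    rw [Real.coe_toNNReal _ (by positivity)]
    push_cast
    rw [div_pow, one_pow]
    rfl
  · rw [Pi.mul_apply, indicator_of_notMem (by exact hz), indicator_of_notMem hz, mul_zero]

/-! ### Gradient form, Möbius maps and periodization. -/

/-- The complex-bilinear extension of the Euclidean inner product of gradients. -/
noncomputable def gradForm (F G : ℂ → ℂ) (w : ℂ) : ℂ :=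
  fderiv ℝ F w 1 * fderiv ℝ G w 1 + fderiv ℝ F w Complex.I * fderiv ℝ G w Complex.I

/-- The differential of `h` is multiplication by a complex number, a rotation followed by a dilation
by `‖deriv h w‖`; the rotation preserves the form and the dilation enters squared. -/
lemma gradForm_comp_holomorphic {F G h : ℂ → ℂ} {w : ℂ} (hh : DifferentiableAt ℂ h w)
    (hF : DifferentiableAt ℝ F (h w)) (hG : DifferentiableAt ℝ G (h w)) :
    gradForm (F ∘ h) (G ∘ h) w = ((‖deriv h w‖ ^ 2 : ℝ) : ℂ) * gradForm F G (h w) := by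
  have hder : HasFDerivAt h (ContinuousLinearMap.mul ℝ ℂ (deriv h w)) w := by
    convert! hh.hasDerivAt.hasFDerivAt.restrictScalars ℝ using 1
    ext v
    all_goals simp [mul_comm]
  have e1 : deriv h w = (deriv h w).re • (1 : ℂ) + (deriv h w).im • Complex.I := by
    simp [Complex.re_add_im]
  have e2 : deriv h w * Complex.I = (deriv h w).re • Complex.I - (deriv h w).im • (1 : ℂ) := by
    apply Complex.ext <;> simp
  have key : ∀ {F : ℂ → ℂ}, DifferentiableAt ℝ F (h w) →
      fderiv ℝ (F ∘ h) w 1 = (deriv h w).re * fderiv ℝ F (h w) 1 +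
        (deriv h w).im * fderiv ℝ F (h w) Complex.I ∧
      fderiv ℝ (F ∘ h) w Complex.I = (deriv h w).re * fderiv ℝ F (h w) Complex.I -
        (deriv h w).im * fderiv ℝ F (h w) 1 := by
    intro F hF
    rw [(hF.hasFDerivAt.comp w hder).fderiv]
    constructor
    · change fderiv ℝ F (h w) (deriv h w * 1) = _
      conv_lhs => rw [mul_one, e1]
      rw [map_add, map_smul, map_smul, Complex.real_smul, Complex.real_smul]
    · change fderiv ℝ F (h w) (deriv h w * Complex.I) = _
      rw [e2, map_sub, map_smul, map_smul, Complex.real_smul, Complex.real_smul]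
  rw [gradForm, (key hF).1, (key hF).2, (key hG).1, (key hG).2, gradForm,
    ← Complex.normSq_eq_norm_sq, Complex.normSq_apply]
  push_cast
  ring

/-- An element of the modular group as a map of the complex coordinate. -/
noncomputable def mob (σ : modGroup) (w : ℂ) : ℂ := (σ • UpperHalfPlane.ofComplex w : ℍ)

@[simp] lemma mob_coe (σ : modGroup) (z : ℍ) : mob σ z = (σ • z : ℍ) := by simp [mob]

/-- Both `Im (σz) / Im z` and `|σ'(z)|` equal `1 / |cz + d|²`. The conformal factor of the gradient
form is thus absorbed by the weight `y²`, which makes `hypGrad` invariant. -/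
lemma mob_spec (σ : modGroup) (z : ℍ) :
    AnalyticAt ℂ (mob σ) z ∧ z.im ^ 2 * ‖deriv (mob σ) z‖ ^ 2 = (σ • z).im ^ 2 := by
  obtain ⟨γ, hγ⟩ := modGroup_exists σ
  set g : GL (Fin 2) ℝ := Matrix.SpecialLinearGroup.mapGL ℝ γ with hg
  have hmob : mob σ = fun w => ((g • UpperHalfPlane.ofComplex w : ℍ) : ℂ) := by
    funext w
    exact congrArg _ (hγ _)
  have hdet : g.val.det = 1 := by
    rw [Matrix.SpecialLinearGroup.mapGL_coe_matrix]
    exact (Matrix.SpecialLinearGroup.map (algebraMap ℤ ℝ) γ).det_coe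
  have hpos : 0 < g.val.det := by simp [hdet]
  have hz : σ • z = g • z := hγ z
  have hd : ‖UpperHalfPlane.denom g z‖ ≠ 0 := norm_ne_zero_iff.mpr (UpperHalfPlane.denom_ne_zero g z)
  rw [hmob]
  refine ⟨UpperHalfPlane.analyticAt_smul hpos z, ?_⟩
  rw [UpperHalfPlane.deriv_smul hpos, hz, UpperHalfPlane.im_smul_eq_div_normSq,
    Complex.normSq_eq_norm_sq, Matrix.GeneralLinearGroup.val_det_apply, hdet]
  simp
  field_simp

lemma lift_comp_mob (f : X → ℂ) (σ : modGroup) : lift f ∘ mob σ = lift f := by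
  funext w
  simp only [lift, mob, Function.comp_apply, UpperHalfPlane.ofComplex_apply, proj_modGroup_smul]

@[simp] lemma lift_coe (f : X → ℂ) (z : ℍ) : lift f z = f (proj z) := by
  simp [lift]

/-- The invariant gradient form `y² (F_x G_x + F_y G_y)`. -/
noncomputable def hypGrad (F G : ℂ → ℂ) (z : ℍ) : ℂ := ((z.im ^ 2 : ℝ) : ℂ) * gradForm F G z

lemma hypGrad_comp_mob {F G : ℂ → ℂ} (σ : modGroup) (z : ℍ)
    (hF : DifferentiableAt ℝ F (σ • z : ℍ)) (hG : DifferentiableAt ℝ G (σ • z : ℍ)) :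
    hypGrad (F ∘ mob σ) (G ∘ mob σ) z = hypGrad F G (σ • z) := by
  obtain ⟨h1, h2⟩ := mob_spec σ z
  rw [← mob_coe] at hF hG
  rw [hypGrad, gradForm_comp_holomorphic h1.differentiableAt hF hG, ← mul_assoc,
    ← Complex.ofReal_mul, h2, mob_coe, hypGrad]

/-- Proper discontinuity: only finitely many translates of a compact neighbourhood of `z` meet the
support. Periodizations are therefore locally finite sums, and can be differentiated term by term.
-/
lemma exists_finset_eventually_mob {E : Type*} [Zero E] {χ : ℂ → E} (hχ : HasCompactSupport χ)
    (hs : tsupport χ ⊆ UpperHalfPlane.upperHalfPlaneSet) (z : ℍ) :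
    ∃ s : Finset modGroup, ∀ᶠ w in 𝓝 (z : ℂ), ∀ σ ∉ s, χ (mob σ w) = 0 := by
  obtain ⟨N, hN, hzN⟩ := exists_compact_mem_nhds z
  have hL : IsCompact (UpperHalfPlane.coe ⁻¹' tsupport χ) :=
    UpperHalfPlane.isEmbedding_coe.isInducing.isCompact_preimage' hχ
      (by rwa [UpperHalfPlane.range_coe])
  have hfin := finite_modGroup_inter hN hL
  refine ⟨hfin.toFinset, ?_⟩
  have : UpperHalfPlane.coe '' N ∈ 𝓝 (z : ℂ) := UpperHalfPlane.isOpenEmbedding_coe.isOpenMap.image_mem_nhds hzN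
  filter_upwards [this]
  rintro _ ⟨w, hw, rfl⟩ σ hσ
  by_contra hne
  refine hσ (hfin.mem_toFinset.mpr ⟨σ • w, ⟨w, hw, rfl⟩, ?_⟩)
  rw [mob_coe] at hne
  exact subset_tsupport χ hne

/-- The sum of a function over its translates under the modular group. -/
noncomputable def periodization {E : Type*} [AddCommMonoid E] [TopologicalSpace E] (χ : ℂ → E)
    (w : ℂ) : E := ∑' σ : modGroup, χ (mob σ w)

lemma periodization_eventuallyEq {E : Type*} [AddCommMonoid E] [TopologicalSpace E] {χ : ℂ → E}
    {s : Finset modGroup} {w₀ : ℂ} (h : ∀ᶠ w in 𝓝 w₀, ∀ σ ∉ s, χ (mob σ w) = 0) :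
    periodization χ =ᶠ[𝓝 w₀] fun w => ∑ σ ∈ s, χ (mob σ w) := by
  filter_upwards [h] with w hw
  exact tsum_eq_sum fun σ hσ => hw σ hσ

lemma periodization_smul {E : Type*} [AddCommMonoid E] [TopologicalSpace E] (χ : ℂ → E)
    (τ : modGroup) (z : ℍ) : periodization χ (τ • z : ℍ) = periodization χ z := by
  simp only [periodization, mob_coe, ← mul_smul]
  exact (Equiv.mulRight τ).tsum_eq fun σ => χ (σ • z : ℍ)

lemma contDiffAt_mob (σ : modGroup) (z : ℍ) {n : WithTop ℕ∞} : ContDiffAt ℝ n (mob σ) z :=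
  ((mob_spec σ z).1.contDiffAt (n := n)).restrict_scalars ℝ

lemma contDiffAt_periodization {E : Type*} [NormedAddCommGroup E] [NormedSpace ℝ E] {χ : ℂ → E}
    (hχ : HasCompactSupport χ) (hs : tsupport χ ⊆ UpperHalfPlane.upperHalfPlaneSet)
    {n : WithTop ℕ∞} (hd : ContDiff ℝ n χ) (z : ℍ) : ContDiffAt ℝ n (periodization χ) z := by
  obtain ⟨s, h⟩ := exists_finset_eventually_mob hχ hs z
  refine ContDiffAt.congr_of_eventuallyEq ?_ (periodization_eventuallyEq h)
  exact ContDiffAt.sum fun σ _ => hd.contDiffAt.comp _ (contDiffAt_mob σ z)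

/-! ### Green's formula in the plane. -/

lemma continuous_mul_of_tsupport_subset {a u : ℂ → ℂ} {U : Set ℂ} (hU : IsOpen U)
    (ha : ContinuousOn a U) (hu : Continuous u) (hs : tsupport u ⊆ U) :
    Continuous fun w => a w * u w :=
  (ha.mul hu.continuousOn).continuous_of_tsupport_subset hU ((tsupport_mul_subset_right).trans hs)

lemma integrable_mul_of_tsupport_subset {a u : ℂ → ℂ} {U : Set ℂ} (hU : IsOpen U)
    (ha : ContinuousOn a U) (hu : Continuous u) (hc : HasCompactSupport u) (hs : tsupport u ⊆ U) :
    Integrable fun w => a w * u w :=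
  (continuous_mul_of_tsupport_subset hU ha hu hs).integrable_of_hasCompactSupport hc.mul_left

lemma contDiffOn_fderiv_apply {F : ℂ → ℂ} {U : Set ℂ} (hU : IsOpen U) (hF : ContDiffOn ℝ ∞ F U)
    (v : ℂ) : ContDiffOn ℝ ∞ (fun w => fderiv ℝ F w v) U :=
  (hF.fderiv_of_isOpen hU (by simp)).clm_apply contDiffOn_const

lemma laplacian_eq_fderiv {F : ℂ → ℂ} {U : Set ℂ} (hU : IsOpen U) (hF : ContDiffOn ℝ ∞ F U)
    {w : ℂ} (hw : w ∈ U) : Laplacian.laplacian F w =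
      fderiv ℝ (fun w => fderiv ℝ F w 1) w 1 +
        fderiv ℝ (fun w => fderiv ℝ F w Complex.I) w Complex.I := by
  have hD : DifferentiableAt ℝ (fderiv ℝ F) w :=
    ((hF.fderiv_of_isOpen (m := ∞) hU (by simp)).contDiffAt (hU.mem_nhds hw)).differentiableAt
      (by simp)
  simp only [InnerProductSpace.laplacian_eq_iteratedFDeriv_complexPlane,
    iteratedFDeriv_two_apply]
  rw [fderiv_clm_apply hD (differentiableAt_const _), fderiv_clm_apply hD (differentiableAt_const _)]
  simp

lemma continuousOn_laplacian {F : ℂ → ℂ} {U : Set ℂ} (hU : IsOpen U) (hF : ContDiffOn ℝ ∞ F U) :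
    ContinuousOn (Laplacian.laplacian F) U := by
  have h := fun v => (contDiffOn_fderiv_apply hU (contDiffOn_fderiv_apply hU hF v) v).continuousOn
  exact ((h 1).add (h Complex.I)).congr fun w hw => laplacian_eq_fderiv hU hF hw

lemma continuousOn_gradForm {F G : ℂ → ℂ} {U : Set ℂ} (hU : IsOpen U) (hF : ContDiffOn ℝ ∞ F U)
    (hG : ContDiffOn ℝ ∞ G U) : ContinuousOn (gradForm F G) U := by
  have h := fun v => (contDiffOn_fderiv_apply hU hF v).continuousOn
  have h' := fun v => (contDiffOn_fderiv_apply hU hG v).continuousOn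
  exact ((h 1).mul (h' 1)).add ((h Complex.I).mul (h' Complex.I))

/-- Green's formula against a compactly supported function. -/
lemma integral_gradForm {F u : ℂ → ℂ} {U : Set ℂ} (hU : IsOpen U) (hF : ContDiffOn ℝ ∞ F U)
    (hu : ContDiff ℝ ∞ u) (hc : HasCompactSupport u) (hs : tsupport u ⊆ U) :
    Integrable (gradForm F u) ∧ Integrable (fun w => Laplacian.laplacian F w * u w) ∧
    ∫ w, gradForm F u w = -∫ w, Laplacian.laplacian F w * u w := by
  have hF1 := fun v => contDiffOn_fderiv_apply hU hF v
  have hF2 := fun v => contDiffOn_fderiv_apply hU (hF1 v) v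
  have hu1 : ∀ v, Continuous fun w => fderiv ℝ u w v := fun v =>
    (hu.continuous_fderiv (by simp)).clm_apply continuous_const
  have i1 := fun v => integrable_mul_of_tsupport_subset hU (hF1 v).continuousOn (hu1 v)
    (hc.fderiv_apply ℝ v) ((tsupport_fderiv_apply_subset ℝ v).trans hs)
  have i2 := fun v => integrable_mul_of_tsupport_subset hU (hF2 v).continuousOn hu.continuous hc hs
  have i3 := fun v => integrable_mul_of_tsupport_subset hU (hF1 v).continuousOn hu.continuous hc hs
  -- Integration by parts along the fixed direction `v`. Smoothness of `F` is needed only on the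
  -- support of `u`, so the arbitrary behaviour of `F` outside `U` is harmless.
  have key := fun v => integral_mul_fderiv_eq_neg_fderiv_mul_of_integrable (𝕜 := ℂ) (μ := volume)
    (i2 v) (i1 v) (i3 v)
    (fun w hw => ((hF1 v).contDiffAt (hU.mem_nhds (hs hw))).differentiableAt (by simp))
    (fun w _ => (hu.differentiable (by simp)).differentiableAt)
  have hlap : (fun w => Laplacian.laplacian F w * u w) = fun w =>
      fderiv ℝ (fun w => fderiv ℝ F w 1) w 1 * u w +
        fderiv ℝ (fun w => fderiv ℝ F w Complex.I) w Complex.I * u w := by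
    funext w
    by_cases hw : w ∈ U
    · rw [laplacian_eq_fderiv hU hF hw, add_mul]
    · simp [image_eq_zero_of_notMem_tsupport fun h => hw (hs h)]
  refine ⟨(i1 1).add (i1 Complex.I), ?_, ?_⟩
  · rw [hlap]
    exact (i2 1).add (i2 Complex.I)
  · rw [hlap, integral_add (i2 1) (i2 Complex.I), neg_add, ← key, ← key,
      ← integral_add (i1 1) (i1 Complex.I)]
    rfl

/-! ### Test functions, unfolding and Green's formula on the modular curve. -/

open UpperHalfPlane (upperHalfPlaneSet isOpen_upperHalfPlaneSet)

lemma contDiffOn_lift (f : testFunctions) : ContDiffOn ℝ ∞ (lift f) upperHalfPlaneSet := f.2.1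

lemma contDiffAt_lift (f : testFunctions) (z : ℍ) : ContDiffAt ℝ ∞ (lift f) z :=
  f.2.1.contDiffAt (isOpen_upperHalfPlaneSet.mem_nhds z.im_pos)

lemma continuous_of_comp_proj {F : X → ℂ} (h : Continuous fun z => F (proj z)) : Continuous F :=
  isOpenQuotientMap_proj.isQuotientMap.continuous_iff.mpr h

lemma continuous_comp_coe {G : ℂ → ℂ} (h : ContinuousOn G upperHalfPlaneSet) :
    Continuous fun z : ℍ => G z :=
  h.comp_continuous UpperHalfPlane.continuous_coe fun z => z.im_pos

lemma continuous_testFunction (f : testFunctions) : Continuous (f : X → ℂ) := by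
  refine continuous_of_comp_proj ?_
  simpa using continuous_comp_coe (contDiffOn_lift f).continuousOn

lemma lift_eventuallyEq_zero {f : testFunctions} {z : ℍ} (hz : proj z ∉ tsupport (f : X → ℂ)) :
    lift f =ᶠ[𝓝 (z : ℂ)] 0 := by
  have h1 : ∀ᶠ w : ℍ in 𝓝 z, lift f w = 0 := by
    have := (isOpenQuotientMap_proj.continuous.tendsto z).eventually
      ((isClosed_tsupport (f : X → ℂ)).isOpen_compl.mem_nhds hz)
    filter_upwards [this] with w hw
    rw [lift_coe]
    exact image_eq_zero_of_notMem_tsupport hw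
  rw [← UpperHalfPlane.isOpenEmbedding_coe.map_nhds_eq z] 
  exact h1

lemma exists_contDiff_bump {C : Set ℂ} (hC : IsCompact C) {U : Set ℂ} (hU : IsOpen U)
    (hCU : C ⊆ U) : ∃ χ : ℂ → ℝ, ContDiff ℝ ∞ χ ∧ HasCompactSupport χ ∧ tsupport χ ⊆ U ∧
      (∀ w, 0 ≤ χ w) ∧ ∀ w ∈ C, χ w = 1 := by
  obtain ⟨L, hL, hCL, hLU⟩ := exists_compact_between hC hU hCU
  obtain ⟨χ, h1, h0, h2⟩ := exists_contMDiffMap_one_nhds_of_subset_interior (n := (⊤ : ℕ∞))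
    (modelWithCornersSelf ℝ ℂ) hC.isClosed hCL
  have hsub : tsupport χ ⊆ L := closure_minimal
    (fun w hw => by_contra fun h => hw (h0 w h)) hL.isClosed
  exact ⟨χ, χ.contMDiff.contDiff, hL.of_isClosed_subset (isClosed_tsupport _) hsub,
    hsub.trans hLU, fun w => (h2 w).1, fun w hw => h1.self_of_nhdsSet w hw⟩

/-- Every test function on the modular curve is the sum of the translates of a smooth compactly
supported function on the upper half-plane. -/
lemma exists_periodization_eq (h : testFunctions) :
    ∃ u : ℂ → ℂ, ContDiff ℝ ∞ u ∧ HasCompactSupport u ∧ tsupport u ⊆ upperHalfPlaneSet ∧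
      ∀ z : ℍ, periodization u z = (h : X → ℂ) (proj z) := by
  obtain ⟨C, hC, hKC⟩ := exists_isCompact_subset_image_proj h.2.2
  obtain ⟨χ, hχ, hχc, hχs, hχ0, hχ1⟩ := exists_contDiff_bump
    (hC.image UpperHalfPlane.continuous_coe) isOpen_upperHalfPlaneSet
    (by rintro _ ⟨z, -, rfl⟩; exact z.im_pos)
  -- Over the support of `h` some translate of the point lies where `χ = 1`, so the non-negative sum
  -- `P` does not vanish there.
  set P := periodization χ with hP
  have hPpos : ∀ z : ℍ, proj z ∈ tsupport (h : X → ℂ) → P z ≠ 0 := by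
    intro z hz
    obtain ⟨w, hw, hwz⟩ := hKC hz
    obtain ⟨γ, rfl⟩ := exists_eq_smul_of_proj_eq hwz
    obtain ⟨s, hs⟩ := exists_finset_eventually_mob hχc hχs z
    rw [hP, (periodization_eventuallyEq hs).self_of_nhds]
    have h1 : χ (mob (toModGroup γ) z) = 1 := by
      rw [mob_coe]
      exact hχ1 _ ⟨_, interior_subset hw, rfl⟩
    refine (Finset.sum_pos' (fun σ _ => hχ0 _) ⟨toModGroup γ, ?_, by rw [h1]; exact one_pos⟩).ne'
    by_contra hmem
    exact one_ne_zero (h1.symm.trans (hs.self_of_nhds _ hmem))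
  -- The translates of `χ / P` add up to `1` wherever `P ≠ 0`. Zeros of `P` do no harm: they lie off
  -- the support of `h`, where `lift h` vanishes in a neighbourhood.
  set u : ℂ → ℂ := fun w => ((χ w * (P w)⁻¹ : ℝ) : ℂ) * lift h w with hu
  have hsupp : Function.support u ⊆ tsupport χ := by
    intro w hw
    refine subset_tsupport χ fun h0 => hw ?_
    simp [hu, h0]
  have hts : tsupport u ⊆ tsupport χ := closure_minimal hsupp (isClosed_tsupport _)
  refine ⟨u, ?_, hχc.of_isClosed_subset (isClosed_tsupport _) hts, hts.trans hχs, fun z => ?_⟩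
  · rw [contDiff_iff_contDiffAt]
    intro w
    by_cases hw : w ∈ tsupport χ
    · obtain ⟨z, rfl⟩ : ∃ z : ℍ, (z : ℂ) = w := ⟨⟨w, hχs hw⟩, rfl⟩
      by_cases hz : proj z ∈ tsupport (h : X → ℂ)
      · have hPs : ContDiffAt ℝ ∞ P z := contDiffAt_periodization hχc hχs hχ z
        exact (Complex.ofRealCLM.contDiff.contDiffAt.comp (z : ℂ)
          (hχ.contDiffAt.mul (hPs.inv (hPpos z hz)))).mul (contDiffAt_lift h z)
      · refine (contDiffAt_const (c := (0 : ℂ))).congr_of_eventuallyEq ?_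
        filter_upwards [lift_eventuallyEq_zero hz] with w hw
        simp [hu, hw]
    · refine (contDiffAt_const (c := (0 : ℂ))).congr_of_eventuallyEq ?_
      exact notMem_tsupport_iff_eventuallyEq.mp fun h => hw (hts h)
  · have h1 : ∀ σ : modGroup, u (mob σ z) =
        ((χ (mob σ z) * (P z)⁻¹ : ℝ) : ℂ) * (h : X → ℂ) (proj z) := by
      intro σ
      simp only [hu, mob_coe, lift_coe, proj_modGroup_smul]
      rw [hP, periodization_smul]
    have h2 : periodization u z = ((P z * (P z)⁻¹ : ℝ) : ℂ) * (h : X → ℂ) (proj z) := by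
      rw [periodization]
      simp_rw [h1]
      rw [tsum_mul_right, ← Complex.ofReal_tsum, tsum_mul_right]
      rfl
    rw [h2]
    by_cases hz : proj z ∈ tsupport (h : X → ℂ)
    · rw [mul_inv_cancel₀ (hPpos z hz)]
      simp
    · rw [image_eq_zero_of_notMem_tsupport hz, mul_zero]

/-- The complex-bilinear extension of the inner product of gradients, on the modular curve. -/
noncomputable def gradProduct (f g : testFunctions) : X → ℂ :=
  Quotient.lift (hypGrad (lift f) (lift g)) (by
    rintro _ z ⟨γ, rfl⟩
    have := hypGrad_comp_mob (toModGroup γ) z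
      ((contDiffAt_lift f (toModGroup γ • z)).differentiableAt (by simp))
      ((contDiffAt_lift g (toModGroup γ • z)).differentiableAt (by simp))
    rw [lift_comp_mob, lift_comp_mob] at this
    exact this.symm)

lemma gradProduct_proj (f g : testFunctions) (z : ℍ) :
    gradProduct f g (proj z) = hypGrad (lift f) (lift g) z := rfl

lemma laplacian_proj (f : testFunctions) (z : ℍ) :
    laplacian f (proj z) = hyperbolicLaplacian (lift f) z := rfl

lemma continuous_laplacian (f : testFunctions) : Continuous (laplacian f) := by
  refine continuous_of_comp_proj (Continuous.mul (by fun_prop) ?_)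
  exact continuous_comp_coe (continuousOn_laplacian isOpen_upperHalfPlaneSet (contDiffOn_lift f))

lemma continuous_gradProduct (f g : testFunctions) : Continuous (gradProduct f g) := by
  refine continuous_of_comp_proj (Continuous.mul (by fun_prop) ?_)
  exact continuous_comp_coe (continuousOn_gradForm isOpen_upperHalfPlaneSet (contDiffOn_lift f)
    (contDiffOn_lift g))

lemma hasCompactSupport_laplacian (f : testFunctions) : HasCompactSupport (laplacian f) := by
  refine HasCompactSupport.intro' f.2.2 (isClosed_tsupport _) fun x hx => ?_
  obtain ⟨z, rfl⟩ := isOpenQuotientMap_proj.surjective x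
  rw [laplacian_proj, hyperbolicLaplacian,
    (InnerProductSpace.laplacian_congr_nhds (lift_eventuallyEq_zero hx)).self_of_nhds]
  simp [Pi.zero_def]

lemma hasCompactSupport_gradProduct (f g : testFunctions) :
    HasCompactSupport (gradProduct f g) := by
  refine HasCompactSupport.intro' f.2.2 (isClosed_tsupport _) fun x hx => ?_
  obtain ⟨z, rfl⟩ := isOpenQuotientMap_proj.surjective x
  rw [gradProduct_proj, hypGrad, gradForm, (lift_eventuallyEq_zero hx).fderiv_eq]
  simp

/-- By invariance of `f`, the term at `σ • z` is the gradient form of `lift f` and `u ∘ mob σ` at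
`z`; linearity in the second argument and local finiteness then sum the translates of `u` to `lift
h`. -/
lemma tsum_hypGrad_smul (f h : testFunctions) {u : ℂ → ℂ} (hu : ContDiff ℝ ∞ u)
    (hc : HasCompactSupport u) (hs : tsupport u ⊆ upperHalfPlaneSet)
    (hper : ∀ z : ℍ, periodization u z = (h : X → ℂ) (proj z)) (z : ℍ) :
    ∑' σ : modGroup, hypGrad (lift f) u (σ • z) = hypGrad (lift f) (lift h) z := by
  obtain ⟨s, hsm⟩ := exists_finset_eventually_mob hc hs z
  have hd : ∀ σ : modGroup, DifferentiableAt ℝ (u ∘ mob σ) z := fun σ =>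
    (hu.contDiffAt.comp _ (contDiffAt_mob σ z)).differentiableAt (by simp)
  have h1 : ∀ σ : modGroup, hypGrad (lift f) u (σ • z) = hypGrad (lift f) (u ∘ mob σ) z := by
    intro σ
    conv_rhs => rw [← lift_comp_mob f σ]
    exact (hypGrad_comp_mob σ z ((contDiffAt_lift f (σ • z)).differentiableAt (by simp))
      (hu.contDiffAt.differentiableAt (by simp))).symm
  have h2 : lift h =ᶠ[𝓝 (z : ℂ)] ∑ σ ∈ s, u ∘ mob σ := by
    filter_upwards [periodization_eventuallyEq hsm,
      isOpen_upperHalfPlaneSet.mem_nhds z.im_pos] with w hw hwU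
    lift w to ℍ using hwU
    rw [lift_coe, ← hper, hw]
    simp
  have h3 : fderiv ℝ (lift h) z = ∑ σ ∈ s, fderiv ℝ (u ∘ mob σ) z := by
    rw [h2.fderiv_eq, fderiv_sum fun σ _ => hd σ]
  rw [tsum_eq_sum (s := s)]
  · simp_rw [h1]
    simp only [hypGrad, gradForm, h3, ← Finset.mul_sum, Finset.sum_add_distrib,
      sum_apply]
  · intro σ hσ
    have : u ∘ mob σ =ᶠ[𝓝 (z : ℂ)] 0 := hsm.mono fun w hw => hw σ hσ
    rw [h1, hypGrad, gradForm, this.fderiv_eq]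
    simp

lemma integrable_comp_coe {a : ℍ → ℂ} (ha : Continuous a) {u : ℂ → ℂ} (hc : HasCompactSupport u)
    (hs : tsupport u ⊆ upperHalfPlaneSet) (h0 : ∀ z : ℍ, (z : ℂ) ∉ tsupport u → a z = 0) :
    Integrable a := by
  refine ha.integrable_of_hasCompactSupport
    (HasCompactSupport.intro (K := UpperHalfPlane.coe ⁻¹' tsupport u) ?_ h0)
  exact UpperHalfPlane.isEmbedding_coe.isInducing.isCompact_preimage' hc
      (by rwa [UpperHalfPlane.range_coe])

/-- Green's formula on the modular curve. -/
lemma integral_gradProduct (f h : testFunctions) :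
    ∫ x, gradProduct f h x ∂measure = ∫ x, -laplacian f x * (h : X → ℂ) x ∂measure := by
  obtain ⟨u, hu, hc, hs, hper⟩ := exists_periodization_eq h
  have hU := isOpen_upperHalfPlaneSet
  obtain ⟨-, -, hgreen⟩ := integral_gradForm hU (contDiffOn_lift f) hu hc hs
  have hg0 : ∀ w ∉ tsupport u, gradForm (lift f) u w = 0 := by
    intro w hw
    have : u =ᶠ[𝓝 w] 0 := notMem_tsupport_iff_eventuallyEq.mp hw
    rw [gradForm, this.fderiv_eq]
    simp
  -- Unfolding turns each side into a half-plane integral against the single function `u`; the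
  -- factor `y²` cancels the density `1 / y²`, leaving the Euclidean Green formula.
  have e1 : ∫ x, gradProduct f h x ∂measure = ∫ w, gradForm (lift f) u w := by
    rw [integral_measure (continuous_gradProduct f h).aestronglyMeasurable]
    simp_rw [gradProduct_proj, ← tsum_hypGrad_smul f h hu hc hs hper]
    rw [setIntegral_fd_tsum_smul]
    · simp_rw [hypGrad]
      rw [integral_upperHalfPlane]
      exact setIntegral_eq_integral_of_forall_compl_eq_zero fun w hw => hg0 w fun h => hw (hs h)
    · refine integrable_comp_coe ?_ hc hs fun z hz => by rw [hypGrad, hg0 _ hz, mul_zero]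
      exact Continuous.mul (by fun_prop) (continuous_comp_coe
        (continuousOn_gradForm hU (contDiffOn_lift f) hu.contDiffOn))
  have e2 : ∫ x, laplacian f x * (h : X → ℂ) x ∂measure =
      ∫ w, Laplacian.laplacian (lift f) w * u w := by
    rw [integral_measure (F := fun x => laplacian f x * (h : X → ℂ) x)
      ((continuous_laplacian f).mul (continuous_testFunction h)).aestronglyMeasurable]
    have : ∀ z : ℍ, laplacian f (proj z) * (h : X → ℂ) (proj z) =
        ∑' σ : modGroup, laplacian f (proj (σ • z)) * u (σ • z : ℍ) := by
      intro z
      simp_rw [proj_modGroup_smul]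
      rw [tsum_mul_left, ← hper, periodization]
      simp_rw [mob_coe]
    simp_rw [this]
    rw [setIntegral_fd_tsum_smul (U := fun z => laplacian f (proj z) * u z)]
    · simp_rw [laplacian_proj, hyperbolicLaplacian, mul_assoc]
      rw [integral_upperHalfPlane (fun w => Laplacian.laplacian (lift f) w * u w)]
      exact setIntegral_eq_integral_of_forall_compl_eq_zero fun w hw => by
        rw [image_eq_zero_of_notMem_tsupport fun h => hw (hs h), mul_zero]
    · refine integrable_comp_coe ?_ hc hs fun z hz => by
        rw [image_eq_zero_of_notMem_tsupport hz, mul_zero]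
      exact ((continuous_laplacian f).comp isOpenQuotientMap_proj.continuous).mul
        (hu.continuous.comp UpperHalfPlane.continuous_coe)
  simp_rw [neg_mul]
  rw [integral_neg, e1, e2, hgreen]

/-! ### The energy as Dirichlet integral plus potential. -/

/-- The complex conjugate of a test function. -/
noncomputable def conjTest (f : testFunctions) : testFunctions :=
  ⟨fun x => conj ((f : X → ℂ) x), Complex.conjCLE.contDiff.comp_contDiffOn f.2.1,
    f.2.2.comp_left (map_zero _)⟩

lemma conjTest_apply (f : testFunctions) (x : X) :
    (conjTest f : X → ℂ) x = conj ((f : X → ℂ) x) := rfl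

lemma fderiv_lift_conjTest (f : testFunctions) (w v : ℂ) :
    fderiv ℝ (lift (conjTest f)) w v = conj (fderiv ℝ (lift f) w v) := by
  have : lift (conjTest f) = Complex.conjCLE ∘ lift f := rfl
  rw [this, Complex.conjCLE.comp_fderiv]
  simp

/-- The squared length of the hyperbolic gradient of a test function. -/
noncomputable def gradDensity (f : testFunctions) (x : X) : ℝ := (gradProduct f (conjTest f) x).re

lemma gradDensity_proj (f : testFunctions) (z : ℍ) : gradDensity f (proj z) =
    z.im ^ 2 * (‖fderiv ℝ (lift f) z 1‖ ^ 2 + ‖fderiv ℝ (lift f) z Complex.I‖ ^ 2) := by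
  rw [gradDensity, gradProduct_proj, hypGrad, gradForm, fderiv_lift_conjTest, fderiv_lift_conjTest,
    Complex.mul_conj, Complex.mul_conj, Complex.normSq_eq_norm_sq, Complex.normSq_eq_norm_sq,
    ← Complex.ofReal_add, ← Complex.ofReal_mul, Complex.ofReal_re]

lemma gradDensity_nonneg (f : testFunctions) (x : X) : 0 ≤ gradDensity f x := by
  obtain ⟨z, rfl⟩ := isOpenQuotientMap_proj.surjective x
  rw [gradDensity_proj]
  positivity

lemma gradProduct_conjTest_self (f : testFunctions) (x : X) :
    gradProduct f (conjTest f) x = (gradDensity f x : ℂ) := by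
  obtain ⟨z, rfl⟩ := isOpenQuotientMap_proj.surjective x
  rw [gradDensity_proj, gradProduct_proj, hypGrad, gradForm, fderiv_lift_conjTest,
    fderiv_lift_conjTest, Complex.mul_conj, Complex.mul_conj, Complex.normSq_eq_norm_sq,
    Complex.normSq_eq_norm_sq]
  push_cast
  ring

lemma conj_gradProduct (f g : testFunctions) (x : X) :
    conj (gradProduct g (conjTest f) x) = gradProduct f (conjTest g) x := by
  obtain ⟨z, rfl⟩ := isOpenQuotientMap_proj.surjective x
  simp only [gradProduct_proj, hypGrad, gradForm, fderiv_lift_conjTest, map_mul, map_add,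
    Complex.conj_conj, Complex.conj_ofReal]
  ring

/-- Expand `|a - b|²` and discard `|b|²`. The use is in closability: `g` survives only in the cross
term, which is continuous in `g` for the `L²` norm. -/
lemma gradDensity_sub (f g : testFunctions) (x : X) :
    gradDensity f x ≤ gradDensity (f - g) x + 2 * (gradProduct f (conjTest g) x).re := by
  obtain ⟨z, rfl⟩ := isOpenQuotientMap_proj.surjective x
  have hsub : ∀ v, fderiv ℝ (lift (f - g : testFunctions)) z v =
      fderiv ℝ (lift f) z v - fderiv ℝ (lift g) z v := by
    intro v
    have : lift (f - g : testFunctions) = lift f - lift g := rfl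
    rw [this, fderiv_sub ((contDiffAt_lift f z).differentiableAt (by simp))
      ((contDiffAt_lift g z).differentiableAt (by simp))]
    rfl
  have key : ∀ a b : ℂ, ‖a‖ ^ 2 ≤ ‖a - b‖ ^ 2 + 2 * (a * conj b).re := by
    intro a b
    simp only [← Complex.normSq_eq_norm_sq, Complex.normSq_apply, Complex.sub_re, Complex.sub_im,
      Complex.mul_re, Complex.conj_re, Complex.conj_im]
    nlinarith [mul_self_nonneg b.re, mul_self_nonneg b.im]
  rw [gradDensity_proj, gradDensity_proj, hsub, hsub, gradProduct_proj, hypGrad, gradForm,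
    fderiv_lift_conjTest, fderiv_lift_conjTest, Complex.re_ofReal_mul, Complex.add_re]
  have h1 := key (fderiv ℝ (lift f) z 1) (fderiv ℝ (lift g) z 1)
  have h2 := key (fderiv ℝ (lift f) z Complex.I) (fderiv ℝ (lift g) z Complex.I)
  nlinarith [mul_le_mul_of_nonneg_left (add_le_add h1 h2) (sq_nonneg z.im)]

lemma continuous_gradDensity (f : testFunctions) : Continuous (gradDensity f) :=
  Complex.continuous_re.comp (continuous_gradProduct f (conjTest f))

lemma integrable_gradProduct (f g : testFunctions) : Integrable (gradProduct f g) measure :=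
  (continuous_gradProduct f g).integrable_of_hasCompactSupport (hasCompactSupport_gradProduct f g)

lemma integrable_gradDensity (f : testFunctions) : Integrable (gradDensity f) measure :=
  (integrable_gradProduct f (conjTest f)).re

lemma integrable_laplacian_mul (f g : testFunctions) :
    Integrable (fun x => laplacian f x * (g : X → ℂ) x) measure :=
  ((continuous_laplacian f).mul (continuous_testFunction g)).integrable_of_hasCompactSupport
    g.2.2.mul_left

variable {q : X → ℝ}

lemma integrable_potential_mul (hq : LocallyIntegrable q measure) (f g : testFunctions) :
    Integrable (fun x => (q x : ℂ) * ((f : X → ℂ) x * (g : X → ℂ) x)) measure := by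
  have hq' : LocallyIntegrable (fun x => (q x : ℂ)) measure := fun x => by
    obtain ⟨U, hU, h⟩ := hq x
    exact ⟨U, hU, Integrable.ofReal h⟩
  exact hq'.integrable_smul_right_of_hasCompactSupport
    ((continuous_testFunction f).mul (continuous_testFunction g)) g.2.2.mul_left

/-- Green's formula makes the form symmetric in `f` and `g`; Hermitian symmetry and positivity are
read off from this expression. -/
lemma energy_eq (hq : LocallyIntegrable q measure) (f g : testFunctions) :
    energy q f g = ∫ x, gradProduct f (conjTest g) x ∂measure +
      ∫ x, (q x : ℂ) * ((f : X → ℂ) x * conj ((g : X → ℂ) x)) ∂measure := by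
  rw [integral_gradProduct, ← integral_add]
  · refine integral_congr_ae (.of_forall fun x => ?_)
    simp only [hamiltonian, conjTest_apply]
    ring
  · simpa using (integrable_laplacian_mul f (conjTest g)).neg
  · exact integrable_potential_mul hq f (conjTest g)

lemma integrable_hamiltonian_mul (hq : LocallyIntegrable q measure) (f g : testFunctions) :
    Integrable (fun x => hamiltonian q f x * conj ((g : X → ℂ) x)) measure := by
  refine ((integrable_laplacian_mul f (conjTest g)).neg.add
    (integrable_potential_mul hq f (conjTest g))).congr (.of_forall fun x => ?_)
  simp only [hamiltonian, conjTest_apply, Pi.add_apply, Pi.neg_apply]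
  ring

lemma hamiltonian_add (f₁ f₂ : testFunctions) (x : X) :
    hamiltonian q (f₁ + f₂) x = hamiltonian q f₁ x + hamiltonian q f₂ x := by
  obtain ⟨z, rfl⟩ := isOpenQuotientMap_proj.surjective x
  have : lift ((f₁ : X → ℂ) + f₂) = lift f₁ + lift f₂ := rfl
  have h := ContDiffAt.laplacian_add ((contDiffAt_lift f₁ z).of_le ENat.LEInfty.out)
    ((contDiffAt_lift f₂ z).of_le ENat.LEInfty.out)
  simp only [hamiltonian, laplacian_proj, hyperbolicLaplacian, this, h, Submodule.coe_add,
    Pi.add_apply]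
  ring

lemma hamiltonian_smul (a : ℂ) (f : testFunctions) (x : X) :
    hamiltonian q (a • f) x = a * hamiltonian q f x := by
  obtain ⟨z, rfl⟩ := isOpenQuotientMap_proj.surjective x
  have : lift (a • (f : X → ℂ)) = a • lift f := rfl
  have h := InnerProductSpace.laplacian_smul a
    ((contDiffAt_lift f z).of_le (m := 2) ENat.LEInfty.out)
  simp only [hamiltonian, laplacian_proj, hyperbolicLaplacian, this, h, Submodule.coe_smul,
    Pi.smul_apply, smul_eq_mul]
  ring

lemma energy_add_left (hq : LocallyIntegrable q measure) (f₁ f₂ g : testFunctions) :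
    energy q (f₁ + f₂) g = energy q f₁ g + energy q f₂ g := by
  simp_rw [energy, hamiltonian_add, add_mul]
  exact integral_add (integrable_hamiltonian_mul hq f₁ g) (integrable_hamiltonian_mul hq f₂ g)

lemma energy_smul_left (a : ℂ) (f g : testFunctions) :
    energy q (a • f) g = a * energy q f g := by
  simp_rw [energy, hamiltonian_smul, mul_assoc]
  exact integral_const_mul _ _

lemma energy_conj_symm (hq : LocallyIntegrable q measure) (f g : testFunctions) :
    conj (energy q g f) = energy q f g := by
  rw [energy_eq hq, energy_eq hq, map_add, ← integral_conj, ← integral_conj]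
  simp_rw [conj_gradProduct, map_mul, Complex.conj_conj, Complex.conj_ofReal]
  congr 2
  funext x
  ring

lemma integrable_potential_norm_sq (hq : LocallyIntegrable q measure) (f : testFunctions) :
    Integrable (fun x => q x * ‖(f : X → ℂ) x‖ ^ 2) measure := by
  refine (integrable_potential_mul hq f (conjTest f)).re.congr (.of_forall fun x => ?_)
  change (_ : ℂ).re = _
  rw [conjTest_apply, Complex.mul_conj, Complex.normSq_eq_norm_sq, ← Complex.ofReal_mul]
  exact Complex.ofReal_re _

lemma energy_self_re (hq : LocallyIntegrable q measure) (f : testFunctions) :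
    (energy q f f).re = ∫ x, gradDensity f x ∂measure + ∫ x, q x * ‖(f : X → ℂ) x‖ ^ 2 ∂measure := by
  have h : ∀ x, (q x : ℂ) * ((f : X → ℂ) x * conj ((f : X → ℂ) x)) =
      ((q x * ‖(f : X → ℂ) x‖ ^ 2 : ℝ) : ℂ) := fun x => by
    rw [Complex.mul_conj, Complex.normSq_eq_norm_sq, Complex.ofReal_mul]
  rw [energy_eq hq]
  simp_rw [gradProduct_conjTest_self, h]
  rw [integral_complex_ofReal, integral_complex_ofReal, ← Complex.ofReal_add, Complex.ofReal_re]

lemma ofReal_energy_self_re (hq : LocallyIntegrable q measure) (hq0 : ∀ x, 0 ≤ q x)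
    (f : testFunctions) : ENNReal.ofReal (energy q f f).re =
      ∫⁻ x, ENNReal.ofReal (gradDensity f x) ∂measure +
        ∫⁻ x, ENNReal.ofReal (q x * ‖(f : X → ℂ) x‖ ^ 2) ∂measure := by
  have h1 : ∀ x, 0 ≤ q x * ‖(f : X → ℂ) x‖ ^ 2 := fun x => mul_nonneg (hq0 x) (sq_nonneg _)
  rw [energy_self_re hq, ENNReal.ofReal_add (integral_nonneg (gradDensity_nonneg f))
    (integral_nonneg h1), ofReal_integral_eq_lintegral_ofReal (integrable_gradDensity f)
    (.of_forall (gradDensity_nonneg f)), ofReal_integral_eq_lintegral_ofReal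
    (integrable_potential_norm_sq hq f) (.of_forall h1)]

lemma energy_self_re_nonneg (hq : LocallyIntegrable q measure) (hq0 : ∀ x, 0 ≤ q x)
    (f : testFunctions) : 0 ≤ (energy q f f).re := by
  rw [energy_self_re hq]
  exact add_nonneg (integral_nonneg (gradDensity_nonneg f))
    (integral_nonneg fun x => mul_nonneg (hq0 x) (sq_nonneg _))

/-! ### Poincaré inequalities. -/

section Poincare

variable {α : Type*} [MeasurableSpace α] {m : Measure α}

lemma sq_lintegral_le {f : α → ENNReal} (hf : AEMeasurable f m) :
    (∫⁻ x, f x ∂m) ^ 2 ≤ m univ * ∫⁻ x, f x ^ 2 ∂m := by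
  have h := ENNReal.lintegral_mul_le_Lp_mul_Lq m Real.HolderConjugate.two_two
    (f := fun _ => 1) (g := f) aemeasurable_const hf
  simp only [Pi.mul_apply, one_mul, ENNReal.one_rpow, lintegral_const] at h
  have hsq : ∀ x : ENNReal, (x ^ ((1 : ℝ) / 2)) ^ 2 = x := fun x => by
    rw [← ENNReal.rpow_natCast, ← ENNReal.rpow_mul]; norm_num
  calc (∫⁻ x, f x ∂m) ^ 2 ≤ _ := pow_le_pow_left₀ (zero_le) h 2
    _ = _ := by rw [mul_pow, hsq, hsq]; simp

lemma enorm_add_sq_le (a b : ℂ) : ‖a + b‖ₑ ^ 2 ≤ 2 * (‖a‖ₑ ^ 2 + ‖b‖ₑ ^ 2) := by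
  have h : ‖a + b‖ ^ 2 ≤ 2 * (‖a‖ ^ 2 + ‖b‖ ^ 2) :=
    (pow_le_pow_left₀ (norm_nonneg _) (norm_add_le a b) 2).trans (add_sq_le)
  simp only [← ofReal_norm]
  rw [← ENNReal.ofReal_pow (norm_nonneg _), ← ENNReal.ofReal_pow (norm_nonneg _),
    ← ENNReal.ofReal_pow (norm_nonneg _), ← ENNReal.ofReal_add (by positivity) (by positivity),
    show (2 : ENNReal) = ENNReal.ofReal 2 by simp, ← ENNReal.ofReal_mul (by norm_num)]
  exact ENNReal.ofReal_le_ofReal h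

/-- Integrate `|G p|² ≤ 2 (|G p - G p'|² + |G p'|²)` over all `p` and over `p' ∈ s`. It propagates
an `L²` bound from `s` to the whole space once differences are controlled. -/
lemma measure_mul_lintegral_enorm_sq_le {s : Set α} {G : α → ℂ} (hG : Measurable G) [SFinite m] :
    m s * ∫⁻ p, ‖G p‖ₑ ^ 2 ∂m ≤ 2 * (∫⁻ p, ∫⁻ p', ‖G p - G p'‖ₑ ^ 2 ∂m ∂m +
      m univ * ∫⁻ p in s, ‖G p‖ₑ ^ 2 ∂m) := by
  have hG2 : Measurable fun p => ‖G p‖ₑ ^ 2 := by fun_prop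
  calc m s * ∫⁻ p, ‖G p‖ₑ ^ 2 ∂m = ∫⁻ p, ∫⁻ p' in s, ‖G p‖ₑ ^ 2 ∂m ∂m := by
        simp_rw [setLIntegral_const]
        rw [lintegral_mul_const _ hG2, mul_comm]
    _ ≤ ∫⁻ p, ∫⁻ p' in s, 2 * (‖G p - G p'‖ₑ ^ 2 + ‖G p'‖ₑ ^ 2) ∂m ∂m := by
        refine lintegral_mono fun p => lintegral_mono fun p' => ?_
        simpa using enorm_add_sq_le (G p - G p') (G p')
    _ = ∫⁻ p, 2 * (∫⁻ p' in s, ‖G p - G p'‖ₑ ^ 2 ∂m + ∫⁻ p' in s, ‖G p'‖ₑ ^ 2 ∂m) ∂m := by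
        refine lintegral_congr fun p => ?_
        rw [lintegral_const_mul _ (by fun_prop), lintegral_add_right _ hG2]
    _ ≤ ∫⁻ p, 2 * (∫⁻ p', ‖G p - G p'‖ₑ ^ 2 ∂m + ∫⁻ p' in s, ‖G p'‖ₑ ^ 2 ∂m) ∂m := by
        gcongr
        exact Measure.restrict_le_self
    _ = _ := by
        have : Measurable fun p => ∫⁻ p', ‖G p - G p'‖ₑ ^ 2 ∂m :=
          Measurable.lintegral_prod_right' (f := fun z : α × α => ‖G z.1 - G z.2‖ₑ ^ 2)
            (by fun_prop)
        rw [lintegral_const_mul _ (this.add_const _), lintegral_add_left this, lintegral_const,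
          mul_comm (m univ)]

/-- The total mass times `G p` is `∫ (G p - G p') dp'` plus the integral of `G`. Squaring, applying
Cauchy–Schwarz and integrating in `p` gives the claim multiplied by the total mass, which is then
cancelled. -/
lemma measure_univ_mul_lintegral_enorm_sq_le {G : α → ℂ} (hG : Measurable G)
    (hGi : Integrable G m) [IsFiniteMeasure m] (hm : m univ ≠ 0) :
    m univ * ∫⁻ p, ‖G p‖ₑ ^ 2 ∂m ≤ 2 * (∫⁻ p, ∫⁻ p', ‖G p - G p'‖ₑ ^ 2 ∂m ∂m +
      ‖∫ p, G p ∂m‖ₑ ^ 2) := by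
  have hm' : m univ ≠ ⊤ := measure_ne_top _ _
  have hpt : ∀ p, m univ ^ 2 * ‖G p‖ₑ ^ 2 ≤
      2 * (m univ * ∫⁻ p', ‖G p - G p'‖ₑ ^ 2 ∂m + ‖∫ p, G p ∂m‖ₑ ^ 2) := by
    intro p
    have h1 : (m.real univ : ℂ) * G p = ∫ p', (G p - G p') ∂m + ∫ p', G p' ∂m := by
      rw [integral_sub (integrable_const _) hGi]
      simp
    have h2 : m univ ^ 2 * ‖G p‖ₑ ^ 2 = ‖(m.real univ : ℂ) * G p‖ₑ ^ 2 := by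
      rw [enorm_mul, mul_pow, ← ofReal_norm (m.real univ : ℂ), Complex.norm_real,
        Real.norm_of_nonneg measureReal_nonneg, ofReal_measureReal]
    rw [h2, h1]
    refine (enorm_add_sq_le _ _).trans ?_
    gcongr
    exact (pow_le_pow_left₀ (zero_le) (enorm_integral_le_lintegral_enorm _) 2).trans
      (sq_lintegral_le (by fun_prop))
  have hW : Measurable fun p => ∫⁻ p', ‖G p - G p'‖ₑ ^ 2 ∂m :=
    Measurable.lintegral_prod_right' (f := fun z : α × α => ‖G z.1 - G z.2‖ₑ ^ 2) (by fun_prop)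
  have h := lintegral_mono (μ := m) hpt
  rw [lintegral_const_mul _ (by fun_prop), lintegral_const_mul _ (by fun_prop),
    lintegral_add_left (by fun_prop), lintegral_const_mul _ hW, lintegral_const,
    mul_comm _ (m univ), ← mul_add, mul_left_comm, sq, mul_assoc] at h
  exact (ENNReal.mul_le_mul_iff_right hm hm').mp h

end Poincare

/-- Fundamental theorem of calculus and Cauchy–Schwarz; enlarging the range to the full interval
makes the bound independent of `x` and `y`. -/
lemma enorm_sub_sq_le_lintegral_deriv {φ φ' : ℝ → ℂ} {a b : ℝ}
    (h : ∀ t ∈ Icc a b, HasDerivAt φ (φ' t) t) (hc : ContinuousOn φ' (Icc a b)) {x y : ℝ}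
    (hx : x ∈ Icc a b) (hy : y ∈ Icc a b) :
    ‖φ x - φ y‖ₑ ^ 2 ≤ ENNReal.ofReal (b - a) * ∫⁻ t in Icc a b, ‖φ' t‖ₑ ^ 2 := by
  have hsub : uIcc y x ⊆ Icc a b := uIcc_subset_Icc hy hx
  have h1 : ∫ t in y..x, φ' t = φ x - φ y :=
    intervalIntegral.integral_eq_sub_of_hasDerivAt (fun t ht => h t (hsub ht))
      (hc.mono hsub).intervalIntegrable
  have h2 : ‖φ x - φ y‖ₑ ≤ ∫⁻ t in Icc a b, ‖φ' t‖ₑ := by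
    rw [← h1, ← ofReal_norm, intervalIntegral.norm_intervalIntegral_eq, ofReal_norm]
    refine (enorm_integral_le_lintegral_enorm _).trans (lintegral_mono_set ?_)
    exact uIoc_subset_uIcc.trans hsub
  refine (pow_le_pow_left₀ (zero_le) h2 2).trans ?_
  have := sq_lintegral_le (m := volume.restrict (Icc a b)) (f := fun t => ‖φ' t‖ₑ)
    (hc.aemeasurable measurableSet_Icc).enorm
  simpa using this

/-- A Poincaré inequality on a rectangle. -/
lemma lintegral_rect_enorm_sub_sq_le {F F₁ F₂ : ℝ × ℝ → ℂ} {a b c d : ℝ} {L : ENNReal}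
    (hF₁ : Measurable F₁) (hF₂ : Measurable F₂)
    (h₁ : ∀ x ∈ Icc a b, ∀ y ∈ Icc c d, HasDerivAt (fun s => F (s, y)) (F₁ (x, y)) x)
    (h₂ : ∀ x ∈ Icc a b, ∀ y ∈ Icc c d, HasDerivAt (fun t => F (x, t)) (F₂ (x, y)) y)
    (hc₁ : ContinuousOn F₁ (Icc a b ×ˢ Icc c d)) (hc₂ : ContinuousOn F₂ (Icc a b ×ˢ Icc c d))
    (hab : ENNReal.ofReal (b - a) ≤ L) (hcd : ENNReal.ofReal (d - c) ≤ L) :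
    ∫⁻ p in Icc a b ×ˢ Icc c d, ∫⁻ p' in Icc a b ×ˢ Icc c d, ‖F p - F p'‖ₑ ^ 2 ≤
      2 * volume (Icc a b ×ˢ Icc c d) * L ^ 2 *
        ∫⁻ p in Icc a b ×ˢ Icc c d, (‖F₁ p‖ₑ ^ 2 + ‖F₂ p‖ₑ ^ 2) := by
  set Q := Icc a b ×ˢ Icc c d with hQ
  have hQm : MeasurableSet Q := measurableSet_Icc.prod measurableSet_Icc
  set A : ℝ → ENNReal := fun y => ∫⁻ s in Icc a b, ‖F₁ (s, y)‖ₑ ^ 2 with hA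
  set B : ℝ → ENNReal := fun x => ∫⁻ t in Icc c d, ‖F₂ (x, t)‖ₑ ^ 2 with hB
  have hF₁2 : Measurable fun p => ‖F₁ p‖ₑ ^ 2 := by fun_prop
  have hF₂2 : Measurable fun p => ‖F₂ p‖ₑ ^ 2 := by fun_prop
  have hAm : Measurable A := hF₁2.lintegral_prod_left'
  have hBm : Measurable B := hF₂2.lintegral_prod_right'
  have hQr : (volume : Measure (ℝ × ℝ)).restrict Q =
      (volume.restrict (Icc a b)).prod (volume.restrict (Icc c d)) := by
    rw [Measure.prod_restrict, Measure.volume_eq_prod]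
  -- Go from `(x, y)` to `(x', y')` through the corner `(x', y)`. The horizontal leg is bounded by a
  -- function of `y` alone and the vertical leg by a function of `x'` alone, so the remaining
  -- integrations contribute only side lengths and areas.
  have hpt : ∀ p ∈ Q, ∀ p' ∈ Q, ‖F p - F p'‖ₑ ^ 2 ≤ 2 * (L * A p.2 + L * B p'.1) := by
    rintro ⟨x, y⟩ ⟨hx, hy⟩ ⟨x', y'⟩ ⟨hx', hy'⟩
    have e1 := enorm_sub_sq_le_lintegral_deriv (φ := fun s => F (s, y)) (φ' := fun s => F₁ (s, y))
      (fun t ht => h₁ t ht y hy)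
      (hc₁.comp (by fun_prop) fun t ht => ⟨ht, hy⟩) hx hx'
    have e2 := enorm_sub_sq_le_lintegral_deriv (φ := fun t => F (x', t)) (φ' := fun t => F₂ (x', t))
      (fun t ht => h₂ x' hx' t ht)
      (hc₂.comp (by fun_prop) fun t ht => ⟨hx', ht⟩) hy hy'
    have e3 := enorm_add_sq_le (F (x, y) - F (x', y)) (F (x', y) - F (x', y'))
    rw [sub_add_sub_cancel] at e3
    refine e3.trans ?_
    gcongr
    · exact e1.trans (by gcongr)
    · exact e2.trans (by gcongr)
  have hAi : ∫⁻ p in Q, A p.2 ≤ L * ∫⁻ p in Q, ‖F₁ p‖ₑ ^ 2 := by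
    rw [hQr, lintegral_prod _ (by fun_prop), lintegral_prod_symm _ (by fun_prop)]
    simp only [lintegral_const, Measure.restrict_apply_univ, Real.volume_Icc]
    rw [mul_comm]
    gcongr
  have hBi : ∫⁻ p in Q, B p.1 ≤ L * ∫⁻ p in Q, ‖F₂ p‖ₑ ^ 2 := by
    rw [hQr, lintegral_prod_symm _ (by fun_prop), lintegral_prod _ (by fun_prop)]
    simp only [lintegral_const, Measure.restrict_apply_univ, Real.volume_Icc]
    rw [mul_comm]
    gcongr
  calc ∫⁻ p in Q, ∫⁻ p' in Q, ‖F p - F p'‖ₑ ^ 2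
      ≤ ∫⁻ p in Q, ∫⁻ p' in Q, 2 * (L * A p.2 + L * B p'.1) :=
        setLIntegral_mono' hQm fun p hp => setLIntegral_mono' hQm fun p' hp' => hpt p hp p' hp'
    _ = ∫⁻ p in Q, 2 * (L * A p.2 * volume Q + L * ∫⁻ p' in Q, B p'.1) := by
        refine lintegral_congr fun p => ?_
        rw [lintegral_const_mul _ (by fun_prop), lintegral_add_left (by fun_prop),
          lintegral_const, Measure.restrict_apply_univ, lintegral_const_mul _ (by fun_prop)]
    _ = 2 * (L * (∫⁻ p in Q, A p.2) * volume Q + (L * ∫⁻ p' in Q, B p'.1) * volume Q) := by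
        rw [lintegral_const_mul _ (by fun_prop), lintegral_add_left (by fun_prop),
          lintegral_mul_const _ (by fun_prop), lintegral_const_mul _ (by fun_prop),
          lintegral_const, Measure.restrict_apply_univ]
    _ ≤ 2 * (L * (L * ∫⁻ p in Q, ‖F₁ p‖ₑ ^ 2) * volume Q +
          (L * (L * ∫⁻ p in Q, ‖F₂ p‖ₑ ^ 2)) * volume Q) := by gcongr
    _ = _ := by
        rw [lintegral_add_left hF₁2]
        ring

/-- Outside the open half-plane `ofComplex` takes a constant default value, so measurability holds
on all of `ℂ`. -/
lemma measurable_lift (f : testFunctions) : Measurable (lift f) := by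
  refine Measurable.comp (continuous_testFunction f).measurable (measurable_proj.comp ?_)
  refine measurable_of_restrict_of_restrict_compl isOpen_upperHalfPlaneSet.measurableSet ?_ ?_
  · refine Continuous.measurable ?_
    refine continuousOn_iff_continuous_domRestrict.mp fun w hw => ?_
    exact (UpperHalfPlane.contMDiffAt_ofComplex (n := 0) hw).continuousAt.continuousWithinAt
  · have : upperHalfPlaneSetᶜ.domRestrict (UpperHalfPlane.ofComplex : ℂ → ℍ) =
        fun _ => UpperHalfPlane.ofComplex 0 := by
      funext w
      exact UpperHalfPlane.ofComplex_apply_eq_of_im_nonpos (not_lt.mp w.2) le_rfl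
    rw [this]
    exact measurable_const

/-- A closed rectangle in the complex plane. -/
def rect (a b c d : ℝ) : Set ℂ := Complex.measurableEquivRealProd ⁻¹' (Icc a b ×ˢ Icc c d)

lemma mem_rect {a b c d : ℝ} {w : ℂ} :
    w ∈ rect a b c d ↔ (a ≤ w.re ∧ w.re ≤ b) ∧ c ≤ w.im ∧ w.im ≤ d := by
  simp [rect, Complex.measurableEquivRealProd_apply]
  tauto

lemma measurableSet_rect (a b c d : ℝ) : MeasurableSet (rect a b c d) :=
  Complex.measurableEquivRealProd.measurable (measurableSet_Icc.prod measurableSet_Icc)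

lemma rect_subset {a b c d : ℝ} (hc : 0 < c) : rect a b c d ⊆ upperHalfPlaneSet :=
  fun _ hw => hc.trans_le (mem_rect.mp hw).2.1

lemma lintegral_rect (a b c d : ℝ) (Φ : ℂ → ENNReal) : ∫⁻ w in rect a b c d, Φ w =
    ∫⁻ p in Icc a b ×ˢ Icc c d, Φ (Complex.measurableEquivRealProd.symm p) := by
  rw [rect, ← Complex.volume_preserving_equiv_real_prod.setLIntegral_comp_preimage_emb
    Complex.measurableEquivRealProd.measurableEmbedding]
  simp

lemma volume_rect (a b c d : ℝ) :
    volume (rect a b c d) = ENNReal.ofReal (b - a) * ENNReal.ofReal (d - c) := by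
  rw [rect, Complex.volume_preserving_equiv_real_prod.measure_preimage_equiv,
    Measure.volume_eq_prod, Measure.prod_prod, Real.volume_Icc, Real.volume_Icc]

lemma volume_rect_ne_top (a b c d : ℝ) : volume (rect a b c d) ≠ ⊤ := by
  rw [volume_rect]
  exact ENNReal.mul_ne_top ENNReal.ofReal_ne_top ENNReal.ofReal_ne_top

/-- The squared Euclidean norm of the gradient. -/
noncomputable def gradSq (F : ℂ → ℂ) (w : ℂ) : ENNReal :=
  ‖fderiv ℝ F w 1‖ₑ ^ 2 + ‖fderiv ℝ F w Complex.I‖ₑ ^ 2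

lemma measurable_gradSq (F : ℂ → ℂ) : Measurable (gradSq F) :=
  ((measurable_fderiv_apply_const ℝ F 1).enorm.pow_const 2).add
    ((measurable_fderiv_apply_const ℝ F Complex.I).enorm.pow_const 2)

lemma lintegral_rect_sub_sq_le {F : ℂ → ℂ} (hF : ContDiffOn ℝ ∞ F upperHalfPlaneSet)
    {a b c d : ℝ} (hc : 0 < c) {L : ENNReal} (hab : ENNReal.ofReal (b - a) ≤ L)
    (hcd : ENNReal.ofReal (d - c) ≤ L) :
    ∫⁻ w in rect a b c d, ∫⁻ w' in rect a b c d, ‖F w - F w'‖ₑ ^ 2 ≤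
      2 * volume (rect a b c d) * L ^ 2 * ∫⁻ w in rect a b c d, gradSq F w := by
  have hU := isOpen_upperHalfPlaneSet
  have hmem : ∀ p ∈ Icc a b ×ˢ Icc c d,
      Complex.measurableEquivRealProd.symm p ∈ upperHalfPlaneSet := fun p hp => by
    refine rect_subset hc (a := a) (b := b) (d := d) ?_
    simpa [rect] using hp
  have hsymm : Continuous (Complex.measurableEquivRealProd.symm : ℝ × ℝ → ℂ) :=
    Complex.equivRealProdCLM.symm.continuous
  have hd : ∀ p ∈ Icc a b ×ˢ Icc c d, HasFDerivAt F
      (fderiv ℝ F (Complex.measurableEquivRealProd.symm p))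
      (Complex.measurableEquivRealProd.symm p) := fun p hp =>
    ((hF.contDiffAt (hU.mem_nhds (hmem p hp))).differentiableAt (by simp)).hasFDerivAt
  have key := lintegral_rect_enorm_sub_sq_le
    (F := fun p => F (Complex.measurableEquivRealProd.symm p))
    (F₁ := fun p => fderiv ℝ F (Complex.measurableEquivRealProd.symm p) 1)
    (F₂ := fun p => fderiv ℝ F (Complex.measurableEquivRealProd.symm p) Complex.I)
    (a := a) (b := b) (c := c) (d := d)
    ((measurable_fderiv_apply_const ℝ F 1).comp hsymm.measurable)
    ((measurable_fderiv_apply_const ℝ F Complex.I).comp hsymm.measurable)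
    (fun x hx y hy => by
      have h : HasDerivAt (fun s : ℝ => Complex.measurableEquivRealProd.symm (s, y)) 1 x := by
        have : (fun s : ℝ => Complex.measurableEquivRealProd.symm (s, y)) =
            fun s : ℝ => (s : ℂ) + y * Complex.I := by
          funext s; apply Complex.ext <;> simp
        rw [this]
        exact (Complex.ofRealCLM.hasDerivAt (x := x)).add_const _
      exact (hd (x, y) ⟨hx, hy⟩).comp_hasDerivAt x h)
    (fun x hx y hy => by
      have h : HasDerivAt (fun t : ℝ => Complex.measurableEquivRealProd.symm (x, t))
          Complex.I y := by
        have : (fun t : ℝ => Complex.measurableEquivRealProd.symm (x, t)) =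
            fun t : ℝ => (x : ℂ) + t * Complex.I := by
          funext s; apply Complex.ext <;> simp
        rw [this]
        simpa using ((Complex.ofRealCLM.hasDerivAt (x := y)).mul_const Complex.I).const_add (x : ℂ)
      exact (hd (x, y) ⟨hx, hy⟩).comp_hasDerivAt y h)
    ((contDiffOn_fderiv_apply hU hF 1).continuousOn.comp hsymm.continuousOn hmem)
    ((contDiffOn_fderiv_apply hU hF Complex.I).continuousOn.comp hsymm.continuousOn hmem) hab hcd
  simp_rw [lintegral_rect]
  have hvol : volume (rect a b c d) = volume (Icc a b ×ˢ Icc c d) :=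
    Complex.volume_preserving_equiv_real_prod.measure_preimage_equiv _
  rw [hvol]
  exact key

/-! ### Comparison of the fundamental domain with a Euclidean half-strip. -/

lemma sqrt_three_div_two_pos : 0 < √3 / 2 := by positivity

/-- The half-strip `|x| ≤ 1/2`, `√3/2 ≤ y ≤ T` contains the part of the fundamental domain
below `T`. -/
lemma fd_inter_subset (T : ℝ) : ModularGroup.fd ∩ {z : ℍ | z.im ≤ T} ⊆
    UpperHalfPlane.coe ⁻¹' rect (-(1 / 2)) (1 / 2) (√3 / 2) T := by
  rintro z ⟨hz, hT⟩
  refine mem_rect.mpr ⟨abs_le.mp hz.2, ?_, hT⟩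
  have h := ModularGroup.three_le_four_mul_im_sq_of_mem_fd hz
  have := z.im_pos
  change √3 / 2 ≤ z.im
  rw [div_le_iff₀ two_pos, Real.sqrt_le_left (by positivity)]
  nlinarith

/-- A point of the half-strip outside `fd` lies inside the unit circle, and `z ↦ -1/z` carries it
into `fd`. -/
lemma rect_subset_union (T : ℝ) :
    UpperHalfPlane.coe ⁻¹' rect (-(1 / 2)) (1 / 2) (√3 / 2) T ⊆
      ModularGroup.fd ∪ (· • ·) (toModGroup ModularGroup.S)⁻¹ '' ModularGroup.fd := by
  intro z hz
  obtain ⟨hre, him, -⟩ := mem_rect.mp hz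
  have hre' : |z.re| ≤ 1 / 2 := abs_le.mpr hre
  have hpos := z.im_pos
  have him2 : 3 ≤ 4 * z.im ^ 2 := by
    have h1 : √3 / 2 ≤ z.im := him
    have h2 := Real.sq_sqrt (show (0 : ℝ) ≤ 3 by norm_num)
    nlinarith [Real.sqrt_nonneg 3]
  by_cases h : 1 ≤ Complex.normSq z
  · exact Or.inl ⟨h, hre'⟩
  · right
    refine ⟨toModGroup ModularGroup.S • z, ?_, by simp⟩
    rw [toModGroup_smul, UpperHalfPlane.modular_S_smul]
    have hn : Complex.normSq (z : ℂ) = z.re ^ 2 + z.im ^ 2 := by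
      rw [Complex.normSq_apply]; simp [sq]
    have hn0 : 0 < Complex.normSq (z : ℂ) := by rw [hn]; positivity
    constructor
    · simp only [map_inv₀, Complex.normSq_neg]
      exact (one_le_inv₀ hn0).mpr (not_le.mp h).le
    · rw [← UpperHalfPlane.coe_re]
      simp only [Complex.inv_re, Complex.neg_re, Complex.normSq_neg,
        UpperHalfPlane.coe_re]
      rw [abs_div, abs_neg, abs_of_pos hn0, div_le_iff₀ hn0, hn, ← sq_abs z.re]
      -- The inequality is `2|x| ≤ x² + y²`; as `y² ≥ 3/4`, it follows from `(|x| - 1/2)(|x| - 3/2)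
      -- ≥ 0`.
      nlinarith [abs_nonneg z.re]

/-- The half-strip is covered by two translates of the fundamental domain. -/
lemma setLIntegral_rect_le {Φ : ℍ → ENNReal} (hΦ : ∀ (σ : modGroup) (z), Φ (σ • z) = Φ z) (T : ℝ) :
    ∫⁻ z in UpperHalfPlane.coe ⁻¹' rect (-(1 / 2)) (1 / 2) (√3 / 2) T, Φ z ≤
      2 * ∫⁻ z in ModularGroup.fd, Φ z := by
  refine (lintegral_mono_set (rect_subset_union T)).trans ((lintegral_union_le _ _ _).trans ?_)
  rw [two_mul]
  exact add_le_add le_rfl ((isFundamentalDomain_fd.smul _).setLIntegral_eq isFundamentalDomain_fd Φ hΦ).le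

/-- The Dirichlet integral is conformally invariant, so the constant does not depend on `T`; the `2`
counts the two domains covering the half-strip. This uniformity lets `T` be fixed before the mesh.
-/
lemma lintegral_rect_gradSq_le (f : testFunctions) (T : ℝ) :
    ∫⁻ w in rect (-(1 / 2)) (1 / 2) (√3 / 2) T, gradSq (lift f) w ≤
      2 * ∫⁻ x, ENNReal.ofReal (gradDensity f x) ∂measure := by
  rw [lintegral_measure (by have := continuous_gradDensity f; fun_prop)]
  refine le_trans ?_ (setLIntegral_rect_le (fun σ z => by rw [proj_modGroup_smul]) T)
  have h : ∀ z : ℍ, ENNReal.ofReal (gradDensity f (proj z)) =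
      (fun w : ℂ => ENNReal.ofReal (w.im ^ 2) * gradSq (lift f) w) z := fun z => by
    rw [gradDensity_proj, ENNReal.ofReal_mul (by positivity), ENNReal.ofReal_add (by positivity)
      (by positivity), ENNReal.ofReal_pow (norm_nonneg _), ENNReal.ofReal_pow (norm_nonneg _),
      ofReal_norm, ofReal_norm]
    rfl
  simp_rw [h]
  rw [lintegral_upperHalfPlane (fun w : ℂ => ENNReal.ofReal (w.im ^ 2) * gradSq (lift f) w) _
    (measurableSet_rect _ _ _ _), inter_eq_left.mpr (rect_subset sqrt_three_div_two_pos)]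
  refine (setLIntegral_congr_fun (measurableSet_rect _ _ _ _) fun w hw => ?_).le
  have hw0 : 0 < w.im := rect_subset sqrt_three_div_two_pos hw
  rw [← mul_assoc, ← ENNReal.ofReal_mul (by positivity), one_div_mul_cancel (by positivity),
    ENNReal.ofReal_one, one_mul]

/-- On `y ≥ √3/2` the density `1 / y²` is at most `4/3`, hence at most `2`. -/
lemma lintegral_fd_inter_le (f : testFunctions) (T : ℝ) :
    ∫⁻ z in ModularGroup.fd ∩ {z : ℍ | z.im ≤ T}, ‖(f : X → ℂ) (proj z)‖ₑ ^ 2 ≤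
      2 * ∫⁻ w in rect (-(1 / 2)) (1 / 2) (√3 / 2) T, ‖lift f w‖ₑ ^ 2 := by
  refine (lintegral_mono_set (fd_inter_subset T)).trans ?_
  simp_rw [← lift_coe]
  rw [lintegral_upperHalfPlane (fun w : ℂ => ‖lift f w‖ₑ ^ 2) _ (measurableSet_rect _ _ _ _),
    inter_eq_left.mpr (rect_subset sqrt_three_div_two_pos),
    ← lintegral_const_mul _ ((measurable_lift f).enorm.pow_const 2)]
  refine setLIntegral_mono' (measurableSet_rect _ _ _ _) fun w hw => ?_
  gcongr
  have h1 : √3 / 2 ≤ w.im := (mem_rect.mp hw).2.1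
  have h2 := Real.sq_sqrt (show (0 : ℝ) ≤ 3 by norm_num)
  have hw0 : 0 < w.im := sqrt_three_div_two_pos.trans_le h1
  rw [← ENNReal.ofReal_ofNat]
  refine ENNReal.ofReal_le_ofReal ?_
  rw [div_le_iff₀ (by positivity)]
  nlinarith [Real.sqrt_nonneg 3]

lemma lintegral_rect_le (f : testFunctions) {a b c T : ℝ} (hc : 0 < c) :
    ∫⁻ w in rect a b c T, ‖lift f w‖ₑ ^ 2 ≤ ENNReal.ofReal (T ^ 2) *
      ∫⁻ z in UpperHalfPlane.coe ⁻¹' rect a b c T, ‖(f : X → ℂ) (proj z)‖ₑ ^ 2 := by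
  simp_rw [← lift_coe]
  rw [lintegral_upperHalfPlane (fun w : ℂ => ‖lift f w‖ₑ ^ 2) _ (measurableSet_rect _ _ _ _),
    inter_eq_left.mpr (rect_subset hc), ← lintegral_const_mul' _ _ ENNReal.ofReal_ne_top]
  refine setLIntegral_mono' (measurableSet_rect _ _ _ _) fun w hw => ?_
  have hw0 : 0 < w.im := rect_subset hc hw
  have hwT : w.im ≤ T := (mem_rect.mp hw).2.2
  rw [← mul_assoc, ← ENNReal.ofReal_mul (by positivity)]
  refine le_mul_of_one_le_left (zero_le) ?_
  rw [← ENNReal.ofReal_one]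
  refine ENNReal.ofReal_le_ofReal ?_
  rw [mul_one_div, le_div_iff₀ (by positivity), one_mul]
  gcongr

lemma lintegral_norm_sq_eq (f : testFunctions) : ∫⁻ x, ‖(f : X → ℂ) x‖ₑ ^ 2 ∂measure =
    ∫⁻ z in ModularGroup.fd, ‖(f : X → ℂ) (proj z)‖ₑ ^ 2 :=
  lintegral_measure (by have := continuous_testFunction f; fun_prop)

lemma lintegral_halfStrip_le (f : testFunctions) (T : ℝ) :
    ∫⁻ w in rect (-(1 / 2)) (1 / 2) (√3 / 2) T, ‖lift f w‖ₑ ^ 2 ≤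
      ENNReal.ofReal (T ^ 2) * (2 * ∫⁻ x, ‖(f : X → ℂ) x‖ₑ ^ 2 ∂measure) := by
  refine (lintegral_rect_le f sqrt_three_div_two_pos).trans ?_
  rw [lintegral_norm_sq_eq]
  exact mul_le_mul_right (setLIntegral_rect_le (fun σ z => by rw [proj_modGroup_smul]) T) _

lemma lintegral_norm_sq_le (f : testFunctions) (T : ℝ) :
    ∫⁻ x, ‖(f : X → ℂ) x‖ₑ ^ 2 ∂measure ≤
      2 * (∫⁻ w in rect (-(1 / 2)) (1 / 2) (√3 / 2) T, ‖lift f w‖ₑ ^ 2) +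
      ∫⁻ z in ModularGroup.fd ∩ {z : ℍ | T ≤ z.im}, ‖(f : X → ℂ) (proj z)‖ₑ ^ 2 := by
  rw [lintegral_norm_sq_eq]
  refine le_trans ?_ (add_le_add (lintegral_fd_inter_le f T) le_rfl)
  refine (lintegral_mono_set ?_).trans (lintegral_union_le _ _ _)
  intro z hz
  rcases le_total z.im T with h | h
  · exact Or.inl ⟨hz, h⟩
  · exact Or.inr ⟨hz, h⟩

/-! ### The cusp, and the bound of the `L²` norm by the energy. -/

section Potential

variable {C c ε : ℝ}

/-- Above height `T` one has `1 ≤ q / (C T^ε)`. All estimates use the growth of `q` through this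
bound alone. -/
lemma lintegral_cusp_le (hq : LocallyIntegrable q measure) (hε : 0 < ε) (hC : 0 < C)
    (hgrowth : ∀ z : ℍ, c ≤ z.im → C * z.im ^ ε ≤ q (proj z)) {T : ℝ} (hT : 0 < T) (hcT : c ≤ T)
    (f : testFunctions) :
    ∫⁻ z in ModularGroup.fd ∩ {z : ℍ | T ≤ z.im}, ‖(f : X → ℂ) (proj z)‖ₑ ^ 2 ≤
      ENNReal.ofReal (C * T ^ ε)⁻¹ *
        ∫⁻ x, ENNReal.ofReal (q x * ‖(f : X → ℂ) x‖ ^ 2) ∂measure := by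
  rw [lintegral_measure (integrable_potential_norm_sq hq f).aemeasurable.ennreal_ofReal,
    ← lintegral_const_mul' _ _ ENNReal.ofReal_ne_top]
  refine le_trans ?_ (lintegral_mono_set (inter_subset_left (t := {z : ℍ | T ≤ z.im})))
  have hm : MeasurableSet (ModularGroup.fd ∩ {z : ℍ | T ≤ z.im}) :=
    measurableSet_fd.inter (isClosed_le continuous_const
      UpperHalfPlane.continuous_im).measurableSet
  refine setLIntegral_mono' hm fun z hz => ?_
  have hTz : T ≤ z.im := hz.2
  have hTε := Real.rpow_pos_of_pos hT ε
  rw [← ENNReal.ofReal_mul (by positivity), ← ofReal_norm, ← ENNReal.ofReal_pow (norm_nonneg _)]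
  refine ENNReal.ofReal_le_ofReal ?_
  rw [← mul_assoc]
  refine le_mul_of_one_le_left (sq_nonneg _) ?_
  rw [inv_mul_eq_div, one_le_div (by positivity)]
  refine le_trans ?_ (hgrowth z (hcT.trans hTz))
  gcongr

/-- The `L²` norm is controlled by the energy. -/
lemma exists_lintegral_norm_sq_le_energy (hq : LocallyIntegrable q measure) (hq0 : ∀ x, 0 ≤ q x)
    (hε : 0 < ε) (hC : 0 < C) (hgrowth : ∀ z : ℍ, c ≤ z.im → C * z.im ^ ε ≤ q (proj z)) :
    ∃ K : ENNReal, K ≠ ⊤ ∧ ∀ f : testFunctions, ∫⁻ x, ‖(f : X → ℂ) x‖ₑ ^ 2 ∂measure ≤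
      K * ENNReal.ofReal (energy q f f).re := by
  set T₀ := max c 1 with hT₀
  have hT₀c : c ≤ T₀ := le_max_left _ _
  have hT₀1 : 1 ≤ T₀ := le_max_right _ _
  set T := T₀ + 1 with hT
  set R := rect (-(1 / 2)) (1 / 2) (√3 / 2) T with hR
  set L := ENNReal.ofReal T with hL
  set k := ENNReal.ofReal (C * T₀ ^ ε)⁻¹ with hk
  have h3 : √3 / 2 ≤ 1 := by
    rw [div_le_one two_pos, Real.sqrt_le_left (by norm_num)]
    norm_num
  -- The gradient alone does not control constants, and `q` may vanish low down. The square `s` of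
  -- area one at the top of `R` lies where the growth of `q` applies, and inside `fd` since `T₀ ≥
  -- 1`; the Poincaré inequality spreads the bound on `s` to all of `R`.
  set s := rect (-(1 / 2)) (1 / 2) T₀ T with hs
  have hsR : s ⊆ R := fun w hw => by
    obtain ⟨h1, h2, h4⟩ := mem_rect.mp hw
    exact mem_rect.mpr ⟨h1, (h3.trans hT₀1).trans h2, h4⟩
  have hsfd : UpperHalfPlane.coe ⁻¹' s ⊆ ModularGroup.fd ∩ {z : ℍ | T₀ ≤ z.im} := fun z hz => by
    obtain ⟨h1, h2, h4⟩ := mem_rect.mp hz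
    have h5 : T₀ ≤ z.im := h2
    refine ⟨⟨?_, abs_le.mpr h1⟩, h2⟩
    rw [Complex.normSq_apply]
    change 1 ≤ z.re * z.re + z.im * z.im
    nlinarith [mul_self_nonneg z.re]
  have hvs : volume s = 1 := by
    rw [hs, volume_rect]
    norm_num [hT]
  have hvR : volume R ≠ ⊤ := volume_rect_ne_top _ _ _ _
  refine ⟨2 * (2 * (2 * volume R * L ^ 2 * 2 + volume R * (ENNReal.ofReal (T ^ 2) * k))) + k,
    by finiteness, fun f => ?_⟩
  rw [ofReal_energy_self_re hq hq0]
  set G := ∫⁻ x, ENNReal.ofReal (gradDensity f x) ∂measure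
  set V := ∫⁻ x, ENNReal.ofReal (q x * ‖(f : X → ℂ) x‖ ^ 2) ∂measure
  have hcusp := lintegral_cusp_le hq hε hC hgrowth (one_pos.trans_le hT₀1) hT₀c f
  have h1 : ∫⁻ w in s, ‖lift f w‖ₑ ^ 2 ≤ ENNReal.ofReal (T ^ 2) * (k * V) :=
    (lintegral_rect_le f (one_pos.trans_le hT₀1)).trans
      (mul_le_mul_right ((lintegral_mono_set hsfd).trans hcusp) _)
  have h2 : ∫⁻ z in ModularGroup.fd ∩ {z : ℍ | T ≤ z.im}, ‖(f : X → ℂ) (proj z)‖ₑ ^ 2 ≤ k * V :=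
    (lintegral_mono_set (show ModularGroup.fd ∩ {z : ℍ | T ≤ z.im} ⊆
      ModularGroup.fd ∩ {z : ℍ | T₀ ≤ z.im} from fun z hz =>
        ⟨hz.1, (by linarith : T₀ ≤ T).trans hz.2⟩)).trans hcusp
  have h4 := lintegral_rect_sub_sq_le (contDiffOn_lift f) (a := -(1 / 2)) (b := 1 / 2)
    (d := T) sqrt_three_div_two_pos (L := L) (ENNReal.ofReal_le_ofReal (by linarith))
    (ENNReal.ofReal_le_ofReal (by linarith [sqrt_three_div_two_pos]))
  have h5 := measure_mul_lintegral_enorm_sq_le (m := volume.restrict R) (s := s)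
    (measurable_lift f)
  rw [Measure.restrict_apply (measurableSet_rect _ _ _ _), inter_eq_left.mpr hsR, hvs, one_mul,
    Measure.restrict_apply_univ, Measure.restrict_restrict (measurableSet_rect _ _ _ _),
    inter_eq_left.mpr hsR] at h5
  have h6 := lintegral_rect_gradSq_le f T
  calc _ ≤ 2 * (∫⁻ w in R, ‖lift f w‖ₑ ^ 2) + k * V :=
        (lintegral_norm_sq_le f T).trans (add_le_add le_rfl h2)
    _ ≤ 2 * (2 * (2 * volume R * L ^ 2 * (2 * G) +
          volume R * (ENNReal.ofReal (T ^ 2) * (k * V)))) + k * V := by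
        refine add_le_add (mul_le_mul_right (h5.trans (mul_le_mul_right (add_le_add
          (h4.trans (mul_le_mul_right h6 _)) (mul_le_mul_right h1 _)) _)) _) le_rfl
    _ ≤ 2 * (2 * (2 * volume R * L ^ 2 * (2 * (G + V)) +
          volume R * (ENNReal.ofReal (T ^ 2) * (k * (G + V))))) + k * (G + V) := by
        gcongr <;> simp
    _ = _ := by ring

end Potential

/-! ### Subdivision into cells and reduction to finitely many functionals. -/

lemma restrict_Icc_eq_sum (a : ℝ) {h : ℝ} (hh : 0 ≤ h) (N : ℕ) :
    (volume : Measure ℝ).restrict (Icc a (a + N * h)) =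
      ∑ i : Fin N, volume.restrict (Icc (a + i * h) (a + (i + 1) * h)) := by
  rw [Fin.sum_univ_eq_sum_range
    (fun i : ℕ => (volume : Measure ℝ).restrict (Icc (a + i * h) (a + (i + 1) * h)))]
  induction N with
  | zero => simp
  | succ n ih =>
    rw [Finset.sum_range_succ, ← ih]
    have h1 : a ≤ a + n * h := by have := mul_nonneg n.cast_nonneg hh (α := ℝ); linarith
    have h2 : a + n * h ≤ a + (n + 1) * h := by linarith
    rw [← restrict_Ioc_eq_restrict_Icc, ← restrict_Ioc_eq_restrict_Icc,
      ← restrict_Ioc_eq_restrict_Icc, ← Measure.restrict_union (Ioc_disjoint_Ioc_of_le le_rfl)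
      measurableSet_Ioc, Ioc_union_Ioc_eq_Ioc h1 h2]
    push_cast
    rfl

/-- The cells of the subdivision of a rectangle. -/
def cell (a c h k : ℝ) {N : ℕ} (i : Fin N × Fin N) : Set ℂ :=
  rect (a + i.1 * h) (a + (i.1 + 1) * h) (c + i.2 * k) (c + (i.2 + 1) * k)

lemma lintegral_rect_eq_sum (a c : ℝ) {h k : ℝ} (hh : 0 ≤ h) (hk : 0 ≤ k) (N : ℕ)
    {g : ℂ → ENNReal} (hg : Measurable g) :
    ∫⁻ w in rect a (a + N * h) c (c + N * k), g w =
      ∑ i : Fin N × Fin N, ∫⁻ w in cell a c h k i, g w := by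
  have hg' : Measurable fun p => g (Complex.measurableEquivRealProd.symm p) :=
    hg.comp Complex.measurableEquivRealProd.symm.measurable
  have key : ∀ a b c d, ∫⁻ w in rect a b c d, g w =
      ∫⁻ x in Icc a b, ∫⁻ y in Icc c d, g (Complex.measurableEquivRealProd.symm (x, y)) := by
    intro a b c d
    rw [lintegral_rect, Measure.volume_eq_prod, ← Measure.prod_restrict,
      lintegral_prod _ hg'.aemeasurable]
  simp only [cell, key]
  rw [restrict_Icc_eq_sum a hh, restrict_Icc_eq_sum c hk, lintegral_finsetSum_measure,
    Fintype.sum_prod_type]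
  refine Finset.sum_congr rfl fun i _ => ?_
  simp_rw [lintegral_finsetSum_measure]
  exact lintegral_finsetSum _ fun j _ => hg'.lintegral_prod_right'

lemma integrableOn_lift_rect (f : testFunctions) {a b c d : ℝ} (hc : 0 < c) :
    IntegrableOn (lift f) (rect a b c d) := by
  refine ContinuousOn.integrableOn_compact ?_ ((contDiffOn_lift f).continuousOn.mono
    (rect_subset hc))
  exact Complex.equivRealProdCLM.toHomeomorph.isCompact_preimage.mpr
    (isCompact_Icc.prod isCompact_Icc)

/-- The Poincaré inequality on a rectangle, with the mean value. -/
lemma lintegral_rect_norm_sq_le (f : testFunctions) {a b c d : ℝ} (hc : 0 < c) (hab : a < b)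
    (hcd : c < d) {L : ENNReal} (hL₁ : ENNReal.ofReal (b - a) ≤ L)
    (hL₂ : ENNReal.ofReal (d - c) ≤ L) :
    ∫⁻ w in rect a b c d, ‖lift f w‖ₑ ^ 2 ≤
      4 * L ^ 2 * (∫⁻ w in rect a b c d, gradSq (lift f) w) +
        2 * (volume (rect a b c d))⁻¹ * ‖∫ w in rect a b c d, lift f w‖ₑ ^ 2 := by
  have hv : volume (rect a b c d) ≠ 0 := by
    rw [volume_rect]
    simp [hab, hcd]
  have hv' := volume_rect_ne_top a b c d
  have : IsFiniteMeasure ((volume : Measure ℂ).restrict (rect a b c d)) :=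
    ⟨by rw [Measure.restrict_apply_univ]; exact hv'.lt_top⟩
  have h1 := measure_univ_mul_lintegral_enorm_sq_le (measurable_lift f)
    (integrableOn_lift_rect f hc (a := a) (b := b) (d := d))
    (by rwa [Measure.restrict_apply_univ])
  rw [Measure.restrict_apply_univ] at h1
  have h2 := lintegral_rect_sub_sq_le (contDiffOn_lift f) hc hL₁ hL₂
  have h3 := h1.trans (mul_le_mul_right (add_le_add h2 le_rfl) 2)
  rw [mul_comm, ← ENNReal.le_div_iff_mul_le (.inl hv) (.inl hv'), div_eq_mul_inv] at h3
  refine h3.trans (le_of_eq ?_)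
  rw [mul_add, add_mul]
  congr 1
  · calc _ = (volume (rect a b c d) * (volume (rect a b c d))⁻¹) * (4 * L ^ 2 *
          (∫⁻ w in rect a b c d, gradSq (lift f) w)) := by ring
      _ = _ := by rw [ENNReal.mul_inv_cancel hv hv', one_mul]
  · ring

/-- The integrals of a test function over finitely many rectangles. -/
noncomputable def rectIntegrals {ι : Type} (a b c d : ι → ℝ) (hc : ∀ i, 0 < c i) :
    testFunctions →ₗ[ℂ] (ι → ℂ) where
  toFun f i := ∫ w in rect (a i) (b i) (c i) (d i), lift f w
  map_add' f g := by
    funext i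
    exact integral_add (integrableOn_lift_rect f (hc i)) (integrableOn_lift_rect g (hc i))
  map_smul' r f := by
    funext i
    exact integral_const_mul r _

variable {C c ε : ℝ}

/-- Up to an arbitrarily small multiple of the energy, the `L²` norm is controlled by finitely many
linear functionals which are bounded for the energy. -/
lemma exists_finite_functionals (hq : LocallyIntegrable q measure) (hq0 : ∀ x, 0 ≤ q x)
    (hε : 0 < ε) (hC : 0 < C) (hgrowth : ∀ z : ℍ, c ≤ z.im → C * z.im ^ ε ≤ q (proj z))
    {η : ℝ} (hη : 0 < η) :
    ∃ (ι : Type) (_ : Fintype ι) (A : testFunctions →ₗ[ℂ] (ι → ℂ)) (K K' : ENNReal),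
      K ≠ ⊤ ∧ K' ≠ ⊤ ∧
      (∀ f : testFunctions, ∫⁻ x, ‖(f : X → ℂ) x‖ₑ ^ 2 ∂measure ≤
        ENNReal.ofReal η * ENNReal.ofReal (energy q f f).re + K * ∑ i, ‖A f i‖ₑ ^ 2) ∧
      ∀ (f : testFunctions) i, ‖A f i‖ₑ ^ 2 ≤ K' * ENNReal.ofReal (energy q f f).re := by
  obtain ⟨K₀, hK₀, hpoincare⟩ := exists_lintegral_norm_sq_le_energy hq hq0 hε hC hgrowth
  obtain ⟨T, hTη, hTc, hT1⟩ : ∃ T : ℝ, (C * T ^ ε)⁻¹ ≤ η ∧ c ≤ T ∧ 1 < T := by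
    have h1 : Tendsto (fun T : ℝ => (C * T ^ ε)⁻¹) atTop (𝓝 0) :=
      ((tendsto_rpow_atTop hε).const_mul_atTop hC).inv_tendsto_atTop
    exact ((h1.eventually_le_const hη).and ((eventually_ge_atTop c).and
      (eventually_gt_atTop 1))).exists
  -- The constant is `16 = 2 · 4 · 2`: the density bound on the half-strip, the Poincaré constant of
  -- a cell, and the double covering. Both cell sides, `1 / N` and `(T - √3/2) / N`, are at most `T
  -- / N`.
  obtain ⟨N, hN0, hN⟩ : ∃ N : ℕ, 0 < (N : ℝ) ∧ 16 * (T / N) ^ 2 ≤ η := by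
    have h1 : Tendsto (fun N : ℕ => 16 * (T / N) ^ 2) atTop (𝓝 (16 * 0 ^ 2)) :=
      ((tendsto_const_div_atTop_nhds_zero_nat T).pow 2).const_mul 16
    have h2 := h1.eventually_le_const (show (16 : ℝ) * 0 ^ 2 < η by simpa using hη)
    obtain ⟨N, h3, h4⟩ := (h2.and (eventually_gt_atTop 0)).exists
    exact ⟨N, by exact_mod_cast h4, h3⟩
  have h3 : √3 / 2 ≤ 1 := by
    rw [div_le_one two_pos, Real.sqrt_le_left (by norm_num)]
    norm_num
  have hpos := sqrt_three_div_two_pos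
  set h : ℝ := 1 / N with hh
  set k : ℝ := (T - √3 / 2) / N with hk
  have hh0 : 0 < h := by positivity
  have hk0 : 0 < k := div_pos (by linarith) hN0
  set a : Fin N × Fin N → ℝ := fun i => -(1 / 2) + i.1 * h
  set b : Fin N × Fin N → ℝ := fun i => -(1 / 2) + (i.1 + 1) * h
  set c' : Fin N × Fin N → ℝ := fun i => √3 / 2 + i.2 * k
  set d : Fin N × Fin N → ℝ := fun i => √3 / 2 + (i.2 + 1) * k
  have hc' : ∀ i, 0 < c' i := fun i => by positivity
  set L := ENNReal.ofReal (T / N) with hL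
  set R := rect (-(1 / 2)) (1 / 2) (√3 / 2) T with hR
  have hRN : R = rect (-(1 / 2)) (-(1 / 2) + N * h) (√3 / 2) (√3 / 2 + N * k) := by
    rw [hR, hh, hk, mul_div_cancel₀ _ hN0.ne', mul_div_cancel₀ _ hN0.ne']
    norm_num
  have hba : ∀ i, b i - a i = h := fun i => by simp only [a, b]; ring
  have hdc : ∀ i, d i - c' i = k := fun i => by simp only [c', d]; ring
  have hsum : ∀ {g : ℂ → ENNReal}, Measurable g →
      ∫⁻ w in R, g w = ∑ i, ∫⁻ w in rect (a i) (b i) (c' i) (d i), g w := fun hg => by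
    rw [hRN]
    exact lintegral_rect_eq_sum _ _ hh0.le hk0.le N hg
  have hvol : ∀ i, volume (rect (a i) (b i) (c' i) (d i)) = ENNReal.ofReal h * ENNReal.ofReal k :=
    fun i => by rw [volume_rect, hba, hdc]
  have hL₁ : ENNReal.ofReal h ≤ L := ENNReal.ofReal_le_ofReal (by rw [hh]; gcongr)
  have hL₂ : ENNReal.ofReal k ≤ L := ENNReal.ofReal_le_ofReal (by rw [hk]; gcongr; linarith)
  have hLη : 16 * L ^ 2 ≤ ENNReal.ofReal η := by
    rw [hL, ← ENNReal.ofReal_pow (by positivity), ← ENNReal.ofReal_ofNat,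
      ← ENNReal.ofReal_mul (by norm_num)]
    exact ENNReal.ofReal_le_ofReal hN
  set v := ENNReal.ofReal h * ENNReal.ofReal k with hv
  have hv0 : v ≠ 0 := by simp [hv, hh0, hk0]
  have hvt : v ≠ ⊤ := by finiteness
  refine ⟨Fin N × Fin N, inferInstance, rectIntegrals a b c' d hc', 4 * v⁻¹,
    v * (ENNReal.ofReal (T ^ 2) * (2 * K₀)),
    ENNReal.mul_ne_top (by simp) (ENNReal.inv_ne_top.mpr hv0), by finiteness, fun f => ?_,
    fun f i => ?_⟩
  · have hcusp := lintegral_cusp_le hq hε hC hgrowth (one_pos.trans hT1) hTc f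
    have hgrad := lintegral_rect_gradSq_le f T
    rw [ofReal_energy_self_re hq hq0]
    set G := ∫⁻ x, ENNReal.ofReal (gradDensity f x) ∂measure
    set V := ∫⁻ x, ENNReal.ofReal (q x * ‖(f : X → ℂ) x‖ ^ 2) ∂measure
    have h4 : ∫⁻ w in R, ‖lift f w‖ₑ ^ 2 ≤ 4 * L ^ 2 * (2 * G) +
        2 * v⁻¹ * ∑ i, ‖rectIntegrals a b c' d hc' f i‖ₑ ^ 2 := by
      rw [hsum ((measurable_lift f).enorm.pow_const 2)]
      refine (Finset.sum_le_sum fun i _ => lintegral_rect_norm_sq_le (L := L) f (hc' i)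
        (sub_pos.mp (by rw [hba]; exact hh0)) (sub_pos.mp (by rw [hdc]; exact hk0))
        (by rw [hba]; exact hL₁) (by rw [hdc]; exact hL₂)).trans ?_
      simp_rw [hvol]
      rw [Finset.sum_add_distrib, ← Finset.mul_sum, ← Finset.mul_sum,
        ← hsum (measurable_gradSq _)]
      exact add_le_add (mul_le_mul_right hgrad _) le_rfl
    calc _ ≤ 2 * (4 * L ^ 2 * (2 * G) + 2 * v⁻¹ * ∑ i, ‖rectIntegrals a b c' d hc' f i‖ₑ ^ 2) +
          ENNReal.ofReal (C * T ^ ε)⁻¹ * V :=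
          (lintegral_norm_sq_le f T).trans (add_le_add (mul_le_mul_right h4 _) hcusp)
      _ = 16 * L ^ 2 * G + ENNReal.ofReal (C * T ^ ε)⁻¹ * V +
          4 * v⁻¹ * ∑ i, ‖rectIntegrals a b c' d hc' f i‖ₑ ^ 2 := by ring
      _ ≤ _ := by
          rw [mul_add]
          gcongr
  -- A cell integral is bounded in `L²` of the cell by Cauchy–Schwarz, hence by the energy. The
  -- bound may be large; only its finiteness matters.
  · have h4 : ‖rectIntegrals a b c' d hc' f i‖ₑ ^ 2 ≤
        v * ∫⁻ w in rect (a i) (b i) (c' i) (d i), ‖lift f w‖ₑ ^ 2 := by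
      refine (pow_le_pow_left₀ (zero_le) (enorm_integral_le_lintegral_enorm _) 2).trans ?_
      refine (sq_lintegral_le (measurable_lift f).enorm.aemeasurable).trans (le_of_eq ?_)
      rw [Measure.restrict_apply_univ, hvol]
    have h5 : ∫⁻ w in rect (a i) (b i) (c' i) (d i), ‖lift f w‖ₑ ^ 2 ≤
        ∫⁻ w in R, ‖lift f w‖ₑ ^ 2 := by
      rw [hsum ((measurable_lift f).enorm.pow_const 2)]
      exact Finset.single_le_sum
        (f := fun i => ∫⁻ w in rect (a i) (b i) (c' i) (d i), ‖lift f w‖ₑ ^ 2)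
        (fun _ _ => zero_le) (Finset.mem_univ i)
    calc _ ≤ v * (ENNReal.ofReal (T ^ 2) * (2 * (K₀ * ENNReal.ofReal (energy q f f).re))) :=
          h4.trans (mul_le_mul_right (h5.trans ((lintegral_halfStrip_le f T).trans
            (mul_le_mul_right (mul_le_mul_right (hpoincare f) _) _))) _)
      _ = _ := by ring

/-! ### Total boundedness and the inclusion of the energy space. -/

/-- The image of the ball under `A` is bounded in a finite-dimensional space, so it has a finite net
with centres `A y`, `y` in the ball. When `A x` is close to `A y`, the hypothesis applied to `x - y`
makes `T x` close to `T y`. -/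
lemma totallyBounded_image_ball_of_finite_functionals {E F : Type*} [NormedAddCommGroup E]
    [NormedSpace ℂ E] [NormedAddCommGroup F] [NormedSpace ℂ F] (T : E →ₗ[ℂ] F)
    (h : ∀ η > (0 : ℝ), ∃ (ι : Type) (_ : Fintype ι) (A : E →ₗ[ℂ] (ι → ℂ)) (K K' : ℝ), 0 ≤ K ∧
      (∀ x, ‖T x‖ ^ 2 ≤ η * ‖x‖ ^ 2 + K * ∑ i, ‖A x i‖ ^ 2) ∧ ∀ x i, ‖A x i‖ ^ 2 ≤ K' * ‖x‖ ^ 2) :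
    TotallyBounded (T '' Metric.ball 0 1) := by
  rw [Metric.totallyBounded_iff]
  intro ε hε
  -- As `‖x - y‖² ≤ 4`, this `η` contributes at most `ε² / 2`; the net is fine enough for the
  -- functionals to add at most `ε² / 4`.
  obtain ⟨ι, _, A, K, K', hK, h1, h2⟩ := h (ε ^ 2 / 8) (by positivity)
  have hb : Bornology.IsBounded (A '' Metric.ball 0 1) := by
    refine (Metric.isBounded_iff_subset_closedBall 0).mpr ⟨√|K'|, ?_⟩
    rintro _ ⟨x, hx, rfl⟩
    rw [mem_closedBall_zero_iff, pi_norm_le_iff_of_nonneg (Real.sqrt_nonneg _)]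
    intro i
    refine Real.le_sqrt_of_sq_le ((h2 x i).trans ?_)
    have hx1 : ‖x‖ < 1 := mem_ball_zero_iff.mp hx
    calc K' * ‖x‖ ^ 2 ≤ |K'| * 1 := by
          gcongr
          · exact le_abs_self K'
          · exact pow_le_one₀ (norm_nonneg _) hx1.le
      _ = |K'| := mul_one _
  -- The `+ 1` keeps `M` positive when `K = 0` or `ι` is empty.
  set M : ℝ := K * Fintype.card ι + 1 with hM
  have hM0 : 0 < M := by positivity
  obtain ⟨t', ht'B, ht'f, htc⟩ := exists_subset_image_finite_and.mp
    (Metric.finite_approx_of_totallyBounded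
      (hb.isCompact_closure.totallyBounded.subset subset_closure) (ε / (2 * √M)) (by positivity))
  refine ⟨T '' t', ht'f.image T, ?_⟩
  rintro _ ⟨x, hx, rfl⟩
  obtain ⟨_, ⟨y, hy, rfl⟩, hxy⟩ := mem_iUnion₂.mp (htc (mem_image_of_mem A hx))
  refine mem_iUnion₂.mpr ⟨T y, mem_image_of_mem T hy, ?_⟩
  rw [Metric.mem_ball, dist_eq_norm, ← map_sub] at hxy ⊢
  have hx1 : ‖x‖ < 1 := mem_ball_zero_iff.mp hx
  have hy1 : ‖y‖ < 1 := mem_ball_zero_iff.mp (ht'B hy)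
  have hxy2 : ‖x - y‖ ^ 2 ≤ 4 := by
    have : ‖x - y‖ ≤ 2 := (norm_sub_le x y).trans (by linarith)
    nlinarith [norm_nonneg (x - y)]
  have hi : ∀ i, ‖A (x - y) i‖ ^ 2 ≤ ε ^ 2 / (4 * M) := fun i => by
    have h3 : ‖A (x - y) i‖ ≤ ε / (2 * √M) := (norm_le_pi_norm _ i).trans hxy.le
    refine (pow_le_pow_left₀ (norm_nonneg _) h3 2).trans (le_of_eq ?_)
    rw [div_pow, mul_pow, Real.sq_sqrt hM0.le]
    norm_num
  have hsum : ∑ i, ‖A (x - y) i‖ ^ 2 ≤ Fintype.card ι * (ε ^ 2 / (4 * M)) := by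
    refine (Finset.sum_le_sum fun i _ => hi i).trans (le_of_eq ?_)
    simp
  have hfin : K * (Fintype.card ι * (ε ^ 2 / (4 * M))) ≤ ε ^ 2 / 4 := by
    have : K * (Fintype.card ι * (ε ^ 2 / (4 * M))) = (ε ^ 2 / 4) * ((M - 1) / M) := by
      rw [hM]; field_simp; ring
    rw [this]
    refine mul_le_of_le_one_right (by positivity) ?_
    rw [div_le_one hM0]
    linarith
  refine lt_of_pow_lt_pow_left₀ 2 hε.le ?_
  calc ‖T (x - y)‖ ^ 2 ≤ ε ^ 2 / 8 * ‖x - y‖ ^ 2 + K * ∑ i, ‖A (x - y) i‖ ^ 2 := h1 _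
    _ ≤ ε ^ 2 / 8 * 4 + ε ^ 2 / 4 := by
        gcongr
        exact (mul_le_mul_of_nonneg_left hsum hK).trans hfin
    _ < ε ^ 2 := by nlinarith [pow_pos hε 2]

lemma memLp_testFunction (f : testFunctions) : MemLp (f : X → ℂ) 2 measure :=
  (continuous_testFunction f).memLp_of_hasCompactSupport f.2.2

lemma memLp_laplacian (f : testFunctions) : MemLp (laplacian f) 2 measure :=
  (continuous_laplacian f).memLp_of_hasCompactSupport (hasCompactSupport_laplacian f)

/-- A test function as an element of `L²`. -/
noncomputable def toL2 : testFunctions →ₗ[ℂ] L2 where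
  toFun f := (memLp_testFunction f).toLp
  map_add' _ _ := rfl
  map_smul' _ _ := rfl

lemma coeFn_toL2 (f : testFunctions) : toL2 f =ᵐ[measure] (f : X → ℂ) :=
  (memLp_testFunction f).coeFn_toLp

lemma enorm_toL2_sq (f : testFunctions) :
    ‖toL2 f‖ₑ ^ 2 = ∫⁻ x, ‖(f : X → ℂ) x‖ₑ ^ 2 ∂measure := by
  change ‖(memLp_testFunction f).toLp‖ₑ ^ 2 = _
  rw [Lp.enorm_toLp, eLpNorm_eq_lintegral_rpow_enorm_toReal (by simp) (by simp),
    ← ENNReal.rpow_natCast, ← ENNReal.rpow_mul]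
  simp

/-- Definiteness comes from the `L²` bound: zero energy forces `f = 0` almost everywhere, hence
everywhere by continuity and positivity of the measure on open sets. -/
lemma isInnerProduct_energy (hq : LocallyIntegrable q measure) (hq0 : ∀ x, 0 ≤ q x)
    (hε : 0 < ε) (hC : 0 < C) (hgrowth : ∀ z : ℍ, c ≤ z.im → C * z.im ^ ε ≤ q (proj z)) :
    IsInnerProduct q where
  add_left := energy_add_left hq
  smul_left := energy_smul_left
  conj_symm := energy_conj_symm hq
  nonneg := energy_self_re_nonneg hq hq0
  definite f hf := by
    obtain ⟨K, -, h⟩ := exists_lintegral_norm_sq_le_energy hq hq0 hε hC hgrowth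
    have h1 := h f
    rw [hf, Complex.zero_re, ENNReal.ofReal_zero, mul_zero, nonpos_iff_eq_zero,
      lintegral_eq_zero_iff ((continuous_testFunction f).measurable.enorm.pow_const 2)] at h1
    have h2 : (f : X → ℂ) =ᵐ[measure] fun _ => 0 := h1.mono fun x hx => by simpa using hx
    have h3 := (continuous_testFunction f).ae_eq_iff_eq (μ := measure) continuous_const |>.mp h2
    exact Subtype.ext h3

lemma norm_sq_preV1 (h : IsInnerProduct q) (f : testFunctions) :
    ‖PreV1.of h f‖ ^ 2 = (energy q f f).re :=
  (inner_self_eq_norm_sq (𝕜 := ℂ) (PreV1.of h f)).symm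

lemma enorm_sq_preV1 (h : IsInnerProduct q) (f : testFunctions) :
    ‖PreV1.of h f‖ₑ ^ 2 = ENNReal.ofReal (energy q f f).re := by
  rw [← norm_sq_preV1 h, ENNReal.ofReal_pow (norm_nonneg _), ofReal_norm]

/-- The inclusion of the test functions into `L²`, as a linear map on the energy space. -/
noncomputable def preInclusion (h : IsInnerProduct q) : PreV1 h →ₗ[ℂ] L2 where
  toFun f := toL2 f
  map_add' f g := toL2.map_add f g
  map_smul' r f := toL2.map_smul r f

lemma exists_norm_preInclusion_le (hq : LocallyIntegrable q measure) (hq0 : ∀ x, 0 ≤ q x)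
    (hε : 0 < ε) (hC : 0 < C) (hgrowth : ∀ z : ℍ, c ≤ z.im → C * z.im ^ ε ≤ q (proj z))
    (h : IsInnerProduct q) : ∃ M : ℝ, ∀ f, ‖preInclusion h f‖ ≤ M * ‖f‖ := by
  obtain ⟨K, hK, hle⟩ := exists_lintegral_norm_sq_le_energy hq hq0 hε hC hgrowth
  refine ⟨√K.toReal, fun f => ?_⟩
  obtain ⟨f, rfl⟩ : ∃ g : testFunctions, PreV1.of h g = f := ⟨f, rfl⟩
  have h1 := hle f
  rw [← enorm_toL2_sq, ← enorm_sq_preV1 h] at h1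
  have h2 := ENNReal.toReal_mono (by finiteness) h1
  rw [ENNReal.toReal_mul, ENNReal.toReal_pow, ENNReal.toReal_pow, toReal_enorm, toReal_enorm] at h2
  refine le_of_sq_le_sq ?_ (by positivity)
  rw [mul_pow, Real.sq_sqrt ENNReal.toReal_nonneg]
  exact h2

lemma totallyBounded_preInclusion (hq : LocallyIntegrable q measure) (hq0 : ∀ x, 0 ≤ q x)
    (hε : 0 < ε) (hC : 0 < C) (hgrowth : ∀ z : ℍ, c ≤ z.im → C * z.im ^ ε ≤ q (proj z))
    (h : IsInnerProduct q) : TotallyBounded (preInclusion h '' Metric.ball 0 1) := by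
  refine totallyBounded_image_ball_of_finite_functionals _ fun η hη => ?_
  obtain ⟨ι, hι, A, K, K', hK, hK', h1, h2⟩ :=
    exists_finite_functionals hq hq0 hε hC hgrowth hη
  let A' : PreV1 h →ₗ[ℂ] (ι → ℂ) :=
    { toFun := fun f => A f
      map_add' := fun f g => A.map_add f g
      map_smul' := fun r f => A.map_smul r f }
  refine ⟨ι, hι, A', K.toReal, K'.toReal, ENNReal.toReal_nonneg, fun f => ?_, fun f i => ?_⟩
  · obtain ⟨f, rfl⟩ : ∃ g : testFunctions, PreV1.of h g = f := ⟨f, rfl⟩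
    have h3 := h1 f
    rw [← enorm_toL2_sq, ← enorm_sq_preV1 h] at h3
    have hE : ENNReal.ofReal η * ‖PreV1.of h f‖ₑ ^ 2 ≠ ⊤ := by finiteness
    have hS : K * ∑ i, ‖A f i‖ₑ ^ 2 ≠ ⊤ :=
      ENNReal.mul_ne_top hK (ENNReal.sum_ne_top.mpr fun i _ => by finiteness)
    have h4 := ENNReal.toReal_mono (ENNReal.add_ne_top.mpr ⟨hE, hS⟩) h3
    rw [ENNReal.toReal_add hE hS, ENNReal.toReal_mul,
      ENNReal.toReal_mul, ENNReal.toReal_sum (by finiteness), ENNReal.toReal_ofReal hη.le] at h4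
    simp only [ENNReal.toReal_pow, toReal_enorm] at h4
    exact h4
  · obtain ⟨f, rfl⟩ : ∃ g : testFunctions, PreV1.of h g = f := ⟨f, rfl⟩
    have h3 := h2 f i
    rw [← enorm_sq_preV1 h] at h3
    have h4 := ENNReal.toReal_mono (by finiteness) h3
    rw [ENNReal.toReal_mul] at h4
    simp only [ENNReal.toReal_pow, toReal_enorm] at h4
    exact h4

/-! ### Closability of the energy form. -/

lemma integral_gradDensity_le_energy_and_potential_le_energy
    (hq : LocallyIntegrable q measure) (hq0 : ∀ x, 0 ≤ q x) (f : testFunctions) : ∫ x, gradDensity f x ∂measure ≤ (energy q f f).re ∧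
      ∫ x, q x * ‖(f : X → ℂ) x‖ ^ 2 ∂measure ≤ (energy q f f).re := by
  rw [energy_self_re hq]
  have h1 := integral_nonneg (μ := measure) (f := gradDensity f) (gradDensity_nonneg f)
  have h2 := integral_nonneg (μ := measure) (f := fun x => q x * ‖(f : X → ℂ) x‖ ^ 2)
    fun x => mul_nonneg (hq0 x) (sq_nonneg _)
  exact ⟨by linarith, by linarith⟩

lemma integral_gradDensity_le (hq : LocallyIntegrable q measure) (hq0 : ∀ x, 0 ≤ q x)
    (f g : testFunctions) : ∫ x, gradDensity f x ∂measure ≤ (energy q (f - g) (f - g)).re +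
      2 * (∫ x, gradProduct f (conjTest g) x ∂measure).re := by
  have h1 : ∫ x, gradDensity f x ∂measure ≤ ∫ x, (gradDensity (f - g) x +
      2 * (gradProduct f (conjTest g) x).re) ∂measure :=
    integral_mono (integrable_gradDensity f) ((integrable_gradDensity _).add
      ((integrable_gradProduct f (conjTest g)).re.const_mul 2)) (gradDensity_sub f g)
  have h2 : ∫ x, (gradDensity (f - g) x + 2 * (gradProduct f (conjTest g) x).re) ∂measure =
      ∫ x, gradDensity (f - g) x ∂measure + 2 * ∫ x, (gradProduct f (conjTest g) x).re ∂measure :=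
    (integral_add (integrable_gradDensity _)
      ((integrable_gradProduct f (conjTest g)).re.const_mul 2)).trans
      (congrArg _ (integral_const_mul _ _))
  have h3 : ∫ x, (gradProduct f (conjTest g) x).re ∂measure =
      (∫ x, gradProduct f (conjTest g) x ∂measure).re :=
    integral_re (integrable_gradProduct f (conjTest g))
  rw [h2, h3] at h1
  exact h1.trans (add_le_add (integral_gradDensity_le_energy_and_potential_le_energy hq hq0 _).1 le_rfl)

/-- All derivatives are moved onto `f`, so for fixed `f` the cross term is an `L²` pairing and tends
to `0` as `g` does in `L²`. -/
lemma integral_gradProduct_eq_inner (f g : testFunctions) :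
    ∫ x, gradProduct f (conjTest g) x ∂measure =
      -inner ℂ (toL2 g) ((memLp_laplacian f).toLp) := by
  rw [integral_gradProduct, L2.inner_def, ← integral_neg]
  refine integral_congr_ae ?_
  filter_upwards [coeFn_toL2 g, (memLp_laplacian f).coeFn_toLp] with x h1 h2
  rw [h1, h2, conjTest_apply]
  simp

/-- The gradient part of the energy form is closable. -/
lemma integral_gradDensity_le_of_tendsto (hq : LocallyIntegrable q measure)
    (hq0 : ∀ x, 0 ≤ q x) {f : testFunctions} {g : ℕ → testFunctions} {δ : ℝ}
    (hg : Tendsto (fun m => toL2 (g m)) atTop (𝓝 0))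
    (hδ : ∀ᶠ m in atTop, (energy q (f - g m) (f - g m)).re ≤ δ) :
    ∫ x, gradDensity f x ∂measure ≤ δ := by
  have h1 : Tendsto (fun m => δ + 2 * (∫ x, gradProduct f (conjTest (g m)) x ∂measure).re) atTop
      (𝓝 (δ + 2 * (-inner ℂ (0 : L2) ((memLp_laplacian f).toLp)).re)) := by
    simp_rw [integral_gradProduct_eq_inner]
    exact ((Complex.continuous_re.tendsto _).comp
      (hg.inner tendsto_const_nhds).neg).const_mul 2 |>.const_add δ
  rw [inner_zero_left, neg_zero, Complex.zero_re, mul_zero, add_zero] at h1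
  refine ge_of_tendsto h1 ?_
  filter_upwards [hδ] with m hm
  exact (integral_gradDensity_le hq hq0 f (g m)).trans (add_le_add hm le_rfl)

/-- The potential part of the energy form is closable. -/
lemma integral_potential_le_of_tendsto (hq : LocallyIntegrable q measure)
    (hq0 : ∀ x, 0 ≤ q x) {f : testFunctions} {g : ℕ → testFunctions} {δ : ℝ} (hδ0 : 0 ≤ δ)
    (hg : Tendsto (fun m => toL2 (g m)) atTop (𝓝 0))
    (hδ : ∀ᶠ m in atTop, (energy q (f - g m) (f - g m)).re ≤ δ) :
    ∫ x, q x * ‖(f : X → ℂ) x‖ ^ 2 ∂measure ≤ δ := by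
  have hq1 : ∀ f : testFunctions, ∀ x, 0 ≤ q x * ‖(f : X → ℂ) x‖ ^ 2 := fun f x =>
    mul_nonneg (hq0 x) (sq_nonneg _)
  -- As `q` may be unbounded, `L²` convergence does not pass directly to `∫ q |·|²`. An almost
  -- everywhere convergent subsequence and Fatou's lemma give the required one-sided bound.
  have hmeas : TendstoInMeasure measure (fun m => (g m : X → ℂ)) atTop (0 : X → ℂ) := by
    refine tendstoInMeasure_of_tendsto_eLpNorm (p := 2) (by simp)
      (fun m => (memLp_testFunction (g m)).1) aestronglyMeasurable_zero ?_
    have h1 := hg.enorm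
    rw [enorm_zero] at h1
    refine h1.congr fun m => ?_
    rw [sub_zero]
    exact Lp.enorm_toLp (memLp_testFunction (g m))
  obtain ⟨ns, hns, hae⟩ := hmeas.exists_seq_tendsto_ae
  have hlim : ∀ᵐ x ∂measure, liminf (fun k => ENNReal.ofReal
      (q x * ‖((f - g (ns k) : testFunctions) : X → ℂ) x‖ ^ 2)) atTop =
      ENNReal.ofReal (q x * ‖(f : X → ℂ) x‖ ^ 2) := by
    filter_upwards [hae] with x hx
    refine Tendsto.liminf_eq (ENNReal.tendsto_ofReal (Tendsto.const_mul _ (Tendsto.pow ?_ 2)))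
    have h2 := (hx.const_sub ((f : X → ℂ) x)).norm
    simpa using h2
  have hbound : ∀ᶠ k in atTop, ∫⁻ x, ENNReal.ofReal
      (q x * ‖((f - g (ns k) : testFunctions) : X → ℂ) x‖ ^ 2) ∂measure ≤ ENNReal.ofReal δ := by
    filter_upwards [hns.tendsto_atTop.eventually hδ] with k hk
    rw [← ofReal_integral_eq_lintegral_ofReal (integrable_potential_norm_sq hq _)
      (.of_forall (hq1 _))]
    exact ENNReal.ofReal_le_ofReal ((integral_gradDensity_le_energy_and_potential_le_energy hq hq0 _).2.trans hk)
  rw [← ENNReal.ofReal_le_ofReal_iff hδ0, ofReal_integral_eq_lintegral_ofReal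
    (integrable_potential_norm_sq hq f) (.of_forall (hq1 f)), ← lintegral_congr_ae hlim]
  refine (lintegral_liminf_le' fun k =>
    (integrable_potential_norm_sq hq _).aemeasurable.ennreal_ofReal).trans ?_
  exact liminf_le_of_frequently_le' hbound.frequently

/-- The energy form is closable on `L²`. -/
lemma tendsto_preV1_zero (hq : LocallyIntegrable q measure) (hq0 : ∀ x, 0 ≤ q x)
    (h : IsInnerProduct q) {g : ℕ → testFunctions}
    (hc : CauchySeq fun n => PreV1.of h (g n))
    (hg : Tendsto (fun m => toL2 (g m)) atTop (𝓝 0)) :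
    Tendsto (fun n => PreV1.of h (g n)) atTop (𝓝 0) := by
  rw [Metric.tendsto_atTop]
  intro ε hε
  obtain ⟨N, hN⟩ := Metric.cauchySeq_iff.mp hc (ε / 2) (by positivity)
  refine ⟨N, fun n hn => ?_⟩
  -- Fix `n` and let `m → ∞`: since `g m → 0` in `L²`, the gradient and potential parts of the
  -- energy of `g n` are each at most `(ε / 2)²`, so their sum is below `ε²`.
  have hδ : ∀ᶠ m in atTop, (energy q (g n - g m) (g n - g m)).re ≤ (ε / 2) ^ 2 := by
    filter_upwards [eventually_ge_atTop N] with m hm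
    rw [← norm_sq_preV1 h]
    have h1 := hN n hn m hm
    rw [dist_eq_norm] at h1
    exact pow_le_pow_left₀ (norm_nonneg _) h1.le 2
  have h1 := integral_gradDensity_le_of_tendsto hq hq0 hg hδ
  have h2 := integral_potential_le_of_tendsto hq hq0 (by positivity) hg hδ
  rw [dist_zero_right]
  refine lt_of_pow_lt_pow_left₀ 2 hε.le ?_
  rw [norm_sq_preV1, energy_self_re hq]
  nlinarith [pow_pos hε 2]

end ModularCurve

/-! ### Extension to the completion. -/

theorem mainTheorem5 (q : ModularCurve.X → ℝ)
    (hq_loc : LocallyIntegrable q ModularCurve.measure) (hq_nonneg : ∀ x, 0 ≤ q x)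
    (ε : ℝ) (hε : 0 < ε)
    (hq_growth : ∃ C > 0, ∃ c : ℝ, ∀ z : ℍ, c ≤ z.im → C * z.im ^ ε ≤ q (ModularCurve.proj z)) :
    ∃ h : ModularCurve.IsInnerProduct q,
      ∃ ι : ModularCurve.V1 h →L[ℂ] ModularCurve.L2,
        (∀ f : ModularCurve.testFunctions,
          ι (ModularCurve.toV1 h f) =ᵐ[ModularCurve.measure] (f : ModularCurve.X → ℂ)) ∧
        Function.Injective ι ∧ IsCompactOperator ι := by
  obtain ⟨C, hC, c, hgrowth⟩ := hq_growth
  have h := ModularCurve.isInnerProduct_energy hq_loc hq_nonneg hε hC hgrowth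
  obtain ⟨M, hM⟩ :=
    ModularCurve.exists_norm_preInclusion_le hq_loc hq_nonneg hε hC hgrowth h
  set T : ModularCurve.PreV1 h →L[ℂ] ModularCurve.L2 :=
    (ModularCurve.preInclusion h).mkContinuous M hM
  set e : ModularCurve.PreV1 h →L[ℂ] ModularCurve.V1 h := UniformSpace.Completion.toComplL
  have he : DenseRange e := UniformSpace.Completion.denseRange_coe
  have heu : IsUniformInducing e := UniformSpace.Completion.isUniformInducing_coe _
  have hT : ∀ f, T.extend e (e f) = ModularCurve.preInclusion h f := fun f =>
    T.extend_eq he heu f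
  refine ⟨h, T.extend e, fun f => ?_, ?_, ?_⟩
  · have h1 : T.extend e (ModularCurve.toV1 h f) = ModularCurve.toL2 f := hT _
    rw [h1]
    exact ModularCurve.coeFn_toL2 f
  · rw [injective_iff_map_eq_zero]
    -- A kernel element is the limit of an energy-Cauchy sequence of test functions whose images
    -- tend to `0` in `L²`; closability makes that limit `0`.
    intro x hx
    obtain ⟨y, hy, hyx⟩ := mem_closure_iff_seq_limit.mp (he x)
    choose g hg using hy
    obtain rfl : (fun n => e (g n)) = y := funext hg
    have hc : CauchySeq g := heu.cauchy_map_iff.mp (by rw [map_map]; exact hyx.cauchySeq)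
    have h0 : Tendsto (fun m => ModularCurve.preInclusion h (g m)) atTop (𝓝 0) := by
      have h1 := ((T.extend e).continuous.tendsto x).comp hyx
      rw [hx] at h1
      exact h1.congr fun n => hT (g n)
    have h2 := ModularCurve.tendsto_preV1_zero hq_loc hq_nonneg h (g := g) hc h0
    have h3 := (e.continuous.tendsto 0).comp h2
    rw [map_zero] at h3
    exact tendsto_nhds_unique hyx h3
  · have htb := ModularCurve.totallyBounded_preInclusion hq_loc hq_nonneg hε hC hgrowth h
    rw [← ContinuousLinearMap.coe_coe, isCompactOperator_iff_isCompact_closure_image_ball _ one_pos]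
    refine (htb.closure.subset ?_).closure.isCompact_of_isClosed isClosed_closure
    rintro _ ⟨x, hx, rfl⟩
    -- The ball is open, so test functions of norm below one are dense in it. By continuity its
    -- image lies in the closure of the totally bounded set `htb`, and completeness of `L²` gives
    -- compactness.
    have h1 : x ∈ closure (Metric.ball 0 1 ∩ range e) :=
      he.open_subset_closure_inter Metric.isOpen_ball hx
    refine closure_mono ?_ (image_closure_subset_closure_image (T.extend e).continuous
      (mem_image_of_mem _ h1))
    rintro _ ⟨_, ⟨h2, f, rfl⟩, rfl⟩
    refine ⟨f, ?_, (hT f).symm⟩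
    rw [mem_ball_zero_iff] at h2 ⊢
    rwa [← UniformSpace.Completion.norm_coe (E := ModularCurve.PreV1 h) f]
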